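/- Let $n\ge 0$ be an integer, let $V$ be a complex vector space of dimension $2n+2$, and let $\mathbb P(V)$ be the projective space of lines of $V$. Let $g:\mathcal O_{\mathbb P(V)}(-1)\to V\otimes\mathcal O_{\mathbb P(V)}$ be the tautological inclusion (at the point $x$, the inclusion of the line $x$ in $V$) and let ${}^{T}g:V^*\otimes\mathcal O_{\mathbb P(V)}\to\mathcal O_{\mathbb P(V)}(1)$ be its transpose. An isomorphism $f:V\to V^*$ is called antisymmetric if $f(u)(u)=0$ for all $u\in V$. For such an $f$, the classical null correlation bundle $N(f)$ on $\mathbb P(V)$ is the cohomology of the monad $$0\longrightarrow\mathcal O_{\mathbb P(V)}(-1)\stackrel{g}{\longrightarrow}V\otimes\mathcal O_{\mathbb P(V)}\stackrel{{}^{T}g\circ f}{\longrightarrow}\mathcal O_{\mathbb P(V)}(1)\longrightarrow 0 .$$ 1. Let $f_1,f_2:V\to V^*$ be antisymmetric isomorphisms. Then $N(f_1)\simeq N(f_2)$ as algebraic vector bundles on $\mathbb P(V)$ if and only if there is $a\in\mathbb C^*$ with $f_1=a f_2$. 2. Let $\kappa\in GL(V)$, let $\bar\kappa$ be the automorphism of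 $\mathbb P(V)$ induced by $\kappa$, and let $f:V\to V^*$ be an antisymmetric isomorphism. Then $\bar\kappa^*N(f)\simeq N({}^{T}\kappa\circ f\circ\kappa)$. 3. Let $e_0,\dots,e_{2n+1}$ be a basis of $V$, let $r_0,\dots,r_n\in\mathbb C^*$, and let $f:V\to V^*$ be the antisymmetric isomorphism whose matrix in this basis and its dual basis is antidiagonal with the entries $-r_0,\dots,-r_n,r_n,\dots,r_0$ from the upper right corner to the lower left corner. Let $a_0,\dots,a_{2n+1}$ and $d$ be integers with $a_i+a_{2n+1-i}=d$ for $i=0,\dots,2n+1$. For $t\in\mathbb C^*$ let $\sigma(t)\in GL(V)$ be the automorphism with the diagonal matrix $(t^{a_0},\dots,t^{a_{2n+1}})$ in this basis, and let $\overline{\sigma(t)}$ be the automorphism of $\mathbb P(V)$ induced by it. Then there are isomorphisms $$s_t:\overline{\sigma(t)}^{\,*}N(f)\stackrel{\sim}{\longrightarrow}N(f)\qquad(t\in\mathbb C^*)$$ which are canonical, in the sense that for every point $x$ and every $w\in V$ with $f(w)|_x=0$ the map $s_t$ sends the class of $\sigma(t)w$ in $N(f)_{\overline{\sigma(t)}x}=(\overline{\sigma(t)}^{\,*}N(f))_x$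 to the class of $w$ in $N(f)_x$; and for all $t_1,t_2\in\mathbb C^*$ $$s_{t_1t_2}=s_{t_2}\circ\overline{\sigma(t_2)}^{\,*}(s_{t_1}),$$ where $\overline{\sigma(t_2)}^{\,*}\,\overline{\sigma(t_1)}^{\,*}N(f)$ is identified with $\overline{\sigma(t_1t_2)}^{\,*}N(f)$. -/

import Mathlib

open CategoryTheory Topology
open scoped LinearAlgebra.Projectivization

universe u

namespace NullCorrelation

noncomputable section

/-! ### The projective space of lines of a complex vector space, as an algebraic variety -/

section Variety

variable {V : Type u} [AddCommGroup V] [Module ℂ V]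

/-- The value at `v` of the polynomial function on `V` given by a polynomial expression in linear
forms on `V`. -/
def polyEval (P : MvPolynomial (Module.Dual ℂ V) ℂ) (v : V) : ℂ :=
  MvPolynomial.eval (fun l : Module.Dual ℂ V => l v) P

/-- The set of points of `ℙ(V)` where the homogeneous polynomial function `P` does not vanish (for
homogeneous `P` this does not depend on the representative of the point). -/
def basicOpen (P : MvPolynomial (Module.Dual ℂ V) ℂ) : Set (ℙ ℂ V) :=
  {x | polyEval P x.rep ≠ 0}

/-- The Zariski topology on `ℙ(V)`. -/
instance zariskiTopology : TopologicalSpace (ℙ ℂ V) :=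
  TopologicalSpace.generateFrom {U | ∃ (d : ℕ) (P : MvPolynomial (Module.Dual ℂ V) ℂ),
    P.IsHomogeneous d ∧ U = basicOpen P}

/-- A complex valued function is regular at `x` if, on a Zariski neighbourhood of `x`, it is a
quotient of two homogeneous polynomials of the same degree, with nowhere vanishing denominator.
This depends only on the germ of the function at `x`. -/
def RegularAt (F : ℙ ℂ V → ℂ) (x : ℙ ℂ V) : Prop :=
  ∃ (d : ℕ) (P Q : MvPolynomial (Module.Dual ℂ V) ℂ), P.IsHomogeneous d ∧ Q.IsHomogeneous d ∧
    ∀ᶠ y in 𝓝 x, polyEval Q y.rep ≠ 0 ∧ F y = polyEval P y.rep / polyEval Q y.rep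

theorem polyEval_smul {d : ℕ} {P : MvPolynomial (Module.Dual ℂ V) ℂ} (hP : P.IsHomogeneous d)
    (c : ℂ) (v : V) : polyEval P (c • v) = c ^ d * polyEval P v := by
  unfold polyEval
  rw [MvPolynomial.eval_eq, MvPolynomial.eval_eq, Finset.mul_sum]
  refine Finset.sum_congr rfl fun m hm => ?_
  have h := hP (MvPolynomial.mem_support_iff.mp hm)
  rw [Finsupp.weight_apply, Finsupp.sum] at h
  simp only [Pi.one_apply, smul_eq_mul, mul_one] at h
  simp only [map_smul, smul_eq_mul, mul_pow, Finset.prod_mul_distrib, Finset.prod_pow_eq_pow_sum, h]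
  ring

theorem isOpen_basicOpen {d : ℕ} {P : MvPolynomial (Module.Dual ℂ V) ℂ} (hP : P.IsHomogeneous d) :
    IsOpen (basicOpen P) :=
  TopologicalSpace.isOpen_generateFrom_of_mem ⟨d, P, hP, rfl⟩

theorem eventually_apply_ne_zero (l : Module.Dual ℂ V) {x : ℙ ℂ V} (hx : l x.rep ≠ 0) :
    ∀ᶠ y in 𝓝 x, l y.rep ≠ 0 := by
  have h := (isOpen_basicOpen (MvPolynomial.isHomogeneous_X ℂ l)).mem_nhds (x := x)
    (by simpa [basicOpen, polyEval] using hx)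
  filter_upwards [h] with y hy
  simpa [basicOpen, polyEval] using hy

theorem RegularAt.congr {F G : ℙ ℂ V → ℂ} {x : ℙ ℂ V} (hF : RegularAt F x)
    (h : ∀ᶠ y in 𝓝 x, F y = G y) : RegularAt G x := by
  obtain ⟨d, P, Q, hP, hQ, H⟩ := hF
  refine ⟨d, P, Q, hP, hQ, ?_⟩
  filter_upwards [H, h] with y hy hFG
  exact ⟨hy.1, hFG ▸ hy.2⟩

theorem regularAt_const (c : ℂ) (x : ℙ ℂ V) : RegularAt (fun _ => c) x :=
  ⟨0, MvPolynomial.C c, 1, MvPolynomial.isHomogeneous_C _ c, MvPolynomial.isHomogeneous_one _ _,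
    Filter.Eventually.of_forall fun y => by simp [polyEval]⟩

theorem RegularAt.add {F G : ℙ ℂ V → ℂ} {x : ℙ ℂ V} (hF : RegularAt F x) (hG : RegularAt G x) :
    RegularAt (fun y => F y + G y) x := by
  obtain ⟨d, P, Q, hP, hQ, H⟩ := hF
  obtain ⟨e, R, S, hR, hS, K⟩ := hG
  refine ⟨d + e, P * S + Q * R, Q * S, (hP.mul hS).add (hQ.mul hR), hQ.mul hS, ?_⟩
  filter_upwards [H, K] with y hy ky
  obtain ⟨hy, hy2⟩ := hy
  obtain ⟨ky, ky2⟩ := ky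
  rw [hy2, ky2]
  unfold polyEval at *
  rw [map_mul, map_add, map_mul, map_mul]
  exact ⟨mul_ne_zero hy ky, div_add_div _ _ hy ky⟩

theorem RegularAt.mul {F G : ℙ ℂ V → ℂ} {x : ℙ ℂ V} (hF : RegularAt F x) (hG : RegularAt G x) :
    RegularAt (fun y => F y * G y) x := by
  obtain ⟨d, P, Q, hP, hQ, H⟩ := hF
  obtain ⟨e, R, S, hR, hS, K⟩ := hG
  refine ⟨d + e, P * R, Q * S, hP.mul hR, hQ.mul hS, ?_⟩
  filter_upwards [H, K] with y hy ky
  obtain ⟨hy, hy2⟩ := hy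
  obtain ⟨ky, ky2⟩ := ky
  rw [hy2, ky2]
  unfold polyEval at *
  rw [map_mul, map_mul]
  exact ⟨mul_ne_zero hy ky, div_mul_div_comm _ _ _ _⟩

theorem RegularAt.sub {F G : ℙ ℂ V → ℂ} {x : ℙ ℂ V} (hF : RegularAt F x) (hG : RegularAt G x) :
    RegularAt (fun y => F y - G y) x :=
  (hF.add ((regularAt_const (-1) x).mul hG)).congr (Filter.Eventually.of_forall fun y => by ring)

theorem RegularAt.sum {ι : Type*} {I : Finset ι} {F : ι → ℙ ℂ V → ℂ} {x : ℙ ℂ V}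
    (hF : ∀ i ∈ I, RegularAt (F i) x) : RegularAt (fun y => ∑ i ∈ I, F i y) x := by
  classical
  induction I using Finset.induction_on with
  | empty => simpa using regularAt_const 0 x
  | insert i I hi ih =>
    simp only [Finset.sum_insert hi]
    exact (hF i (by simp)).add (ih fun j hj => hF j (by simp [hj]))

/-- A quotient of two linear forms is regular where the denominator does not vanish. -/
theorem regularAt_div (l m : Module.Dual ℂ V) {x : ℙ ℂ V} (hx : m x.rep ≠ 0) :
    RegularAt (fun y => l y.rep / m y.rep) x := by
  refine ⟨1, MvPolynomial.X l, MvPolynomial.X m, MvPolynomial.isHomogeneous_X _ _,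
    MvPolynomial.isHomogeneous_X _ _, ?_⟩
  filter_upwards [eventually_apply_ne_zero m hx] with y hy
  simpa [polyEval] using hy

end Variety

/-! ### Regular maps between projective spaces -/

/-- A regular map `ℙ(V) → ℙ(W)`: a continuous map which pulls regular functions back to regular
functions. -/
@[ext]
structure RegularMap (V W : Type u) [AddCommGroup V] [Module ℂ V] [AddCommGroup W]
    [Module ℂ W] where
  toFun : ℙ ℂ V → ℙ ℂ W
  continuous_toFun : Continuous toFun
  regular_comp : ∀ (F : ℙ ℂ W → ℂ) (x : ℙ ℂ V), RegularAt F (toFun x) →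
    RegularAt (fun y => F (toFun y)) x

section RegularMaps

variable {V W X : Type u} [AddCommGroup V] [Module ℂ V] [AddCommGroup W] [Module ℂ W]
  [AddCommGroup X] [Module ℂ X]

/-- The composite `h ∘ k`. -/
def RegularMap.comp (h : RegularMap W X) (k : RegularMap V W) : RegularMap V X where
  toFun := fun x => h.toFun (k.toFun x)
  continuous_toFun := h.continuous_toFun.comp k.continuous_toFun
  regular_comp := fun F x hF => k.regular_comp _ x (h.regular_comp F _ hF)

theorem map_rep (κ : V ≃ₗ[ℂ] W) (x : ℙ ℂ V) :
    ∃ c : ℂ, c ≠ 0 ∧ (Projectivization.map κ.toLinearMap κ.injective x).rep = c • κ x.rep := by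
  obtain ⟨a, ha⟩ := Projectivization.exists_smul_eq_mk_rep ℂ (κ x.rep)
    (by simpa using x.rep_nonzero)
  refine ⟨a, a.ne_zero, ?_⟩
  conv_lhs => rw [← x.mk_rep]
  rw [Projectivization.map_mk]
  exact ha.symm

theorem polyEval_rename (κ : V ≃ₗ[ℂ] W) (P : MvPolynomial (Module.Dual ℂ W) ℂ) (v : V) :
    polyEval (MvPolynomial.rename (fun l : Module.Dual ℂ W => l ∘ₗ κ.toLinearMap) P) v =
      polyEval P (κ v) := by
  unfold polyEval
  rw [MvPolynomial.eval_rename]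
  rfl

theorem continuous_projMap (κ : V ≃ₗ[ℂ] W) :
    Continuous (Projectivization.map κ.toLinearMap κ.injective : ℙ ℂ V → ℙ ℂ W) := by
  refine continuous_generateFrom_iff.mpr ?_
  rintro U ⟨d, P, hP, rfl⟩
  have : Projectivization.map κ.toLinearMap κ.injective ⁻¹' basicOpen P =
      basicOpen (MvPolynomial.rename (fun l : Module.Dual ℂ W => l ∘ₗ κ.toLinearMap) P) := by
    ext x
    obtain ⟨c, hc, hx⟩ := map_rep κ x
    simp only [Set.mem_preimage, basicOpen, Set.mem_ofPred_eq, hx, polyEval_smul hP,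
      polyEval_rename]
    simp [hc]
  rw [this]
  exact isOpen_basicOpen hP.rename_isHomogeneous

/-- The regular map `κ̄ : ℙ(V) → ℙ(W)` induced by a linear isomorphism `κ`. -/
def projMap (κ : V ≃ₗ[ℂ] W) : RegularMap V W where
  toFun := Projectivization.map κ.toLinearMap κ.injective
  continuous_toFun := continuous_projMap κ
  regular_comp := by
    rintro F x ⟨d, P, Q, hP, hQ, H⟩
    refine ⟨d, _, _, hP.rename_isHomogeneous
      (f := fun l : Module.Dual ℂ W => l ∘ₗ κ.toLinearMap), hQ.rename_isHomogeneous
      (f := fun l : Module.Dual ℂ W => l ∘ₗ κ.toLinearMap), ?_⟩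
    filter_upwards [(continuous_projMap κ).continuousAt.eventually H] with y hy
    obtain ⟨c, hc, hx⟩ := map_rep κ y
    rw [hx, polyEval_smul hP, polyEval_smul hQ] at hy
    rw [polyEval_rename, polyEval_rename]
    have hcd : c ^ d ≠ 0 := pow_ne_zero _ hc
    exact ⟨fun h => hy.1 (by rw [h, mul_zero]), by rw [hy.2, mul_div_mul_left _ _ hcd]⟩

theorem projMap_trans (κ : V ≃ₗ[ℂ] W) (μ : W ≃ₗ[ℂ] X) :
    projMap (κ.trans μ) = (projMap μ).comp (projMap κ) := by
  ext x
  induction x using Projectivization.ind with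
  | h v hv => simp [projMap, RegularMap.comp, Projectivization.map_mk]

end RegularMaps

/-! ### Algebraic vector bundles on `ℙ(V)` -/

/-- An algebraic vector bundle on `ℙ(V)`: a family of vector spaces together with the notion of a
section which is regular at a point, such that near every point there is a trivialisation of the
family by which the regular sections correspond to the vectors of regular functions. (A section on
an open set is extended by arbitrary values outside; regularity at a point depends only on the
germ. The maps `e y` are only required to be trivialisations for `y` near `x`.) -/
structure AlgVectorBundle (V : Type u) [AddCommGroup V] [Module ℂ V] where
  fibre : ℙ ℂ V → Type u
  [addCommGroup : ∀ x, AddCommGroup (fibre x)]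
  [module : ∀ x, Module ℂ (fibre x)]
  Regular : (∀ x, fibre x) → ℙ ℂ V → Prop
  locallyTrivial : ∀ x, ∃ (r : ℕ) (e : ∀ y, fibre y →ₗ[ℂ] (Fin r → ℂ)), ∀ᶠ y in 𝓝 x,
    Function.Bijective (e y) ∧
      ∀ s : (∀ z, fibre z), Regular s y ↔ ∀ i, RegularAt (fun z => e z (s z) i) y

attribute [instance] AlgVectorBundle.addCommGroup AlgVectorBundle.module

namespace AlgVectorBundle

variable {V : Type u} [AddCommGroup V] [Module ℂ V]

/-- A morphism of algebraic vector bundles: a family of linear maps between the fibres, which maps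
regular sections to regular sections. -/
@[ext]
structure Hom (E F : AlgVectorBundle V) where
  app : ∀ x, E.fibre x →ₗ[ℂ] F.fibre x
  map_regular : ∀ (s : ∀ x, E.fibre x) (x : ℙ ℂ V), E.Regular s x →
    F.Regular (fun y => app y (s y)) x

instance : Category (AlgVectorBundle V) where
  Hom E F := Hom E F
  id E := { app := fun _ => LinearMap.id, map_regular := fun _ _ h => h }
  comp φ ψ :=
    { app := fun x => ψ.app x ∘ₗ φ.app x
      map_regular := fun _ _ h => ψ.map_regular _ _ (φ.map_regular _ _ h) }

/-- Near every point there are a trivialisation and the corresponding frame of regular sections. -/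
theorem exists_frame (E : AlgVectorBundle V) (x : ℙ ℂ V) :
    ∃ (r : ℕ) (e : ∀ y, E.fibre y →ₗ[ℂ] (Fin r → ℂ)) (b : Fin r → ∀ y, E.fibre y),
      ∀ᶠ y in 𝓝 x, Function.Bijective (e y) ∧
        (∀ s : (∀ z, E.fibre z), E.Regular s y ↔ ∀ i, RegularAt (fun z => e z (s z) i) y) ∧
        (∀ i, e y (b i y) = Pi.single i 1) ∧ ∀ i, E.Regular (b i) y := by
  obtain ⟨r, e, he⟩ := E.locallyTrivial x
  let b : Fin r → ∀ y, E.fibre y := fun i y => Function.invFun (e y) (Pi.single i 1)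
  have hb : ∀ y, Function.Bijective (e y) → ∀ i, e y (b i y) = Pi.single i 1 := fun y hy i =>
    Function.invFun_eq (hy.2 _)
  refine ⟨r, e, b, ?_⟩
  filter_upwards [he, eventually_eventually_nhds.mpr he] with y hy hy2
  refine ⟨hy.1, hy.2, hb y hy.1, fun i => (hy.2 _).mpr fun j => ?_⟩
  refine (regularAt_const ((Pi.single i 1 : Fin r → ℂ) j) y).congr ?_
  filter_upwards [hy2] with z hz
  rw [hb z hz.1]

theorem Regular.congr {E : AlgVectorBundle V} {s t : ∀ y, E.fibre y} {x : ℙ ℂ V}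
    (hs : E.Regular s x) (h : ∀ᶠ y in 𝓝 x, s y = t y) : E.Regular t x := by
  obtain ⟨r, e, he⟩ := E.locallyTrivial x
  have hx := he.self_of_nhds.2
  rw [hx] at hs ⊢
  refine fun i => (hs i).congr ?_
  filter_upwards [h] with y hy
  rw [hy]

/-! #### The trivial bundle, the dual bundle, the tautological bundle -/

/-- The trivial bundle `M ⊗ 𝒪`. -/
abbrev trivialBundle (V : Type u) [AddCommGroup V] [Module ℂ V] (M : Type u) [AddCommGroup M]
    [Module ℂ M] [FiniteDimensional ℂ M] : AlgVectorBundle V where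
  fibre := fun _ => M
  Regular := fun s x => ∀ l : Module.Dual ℂ M, RegularAt (fun y => l (s y)) x
  locallyTrivial := fun x => by
    let b := Module.finBasis ℂ M
    refine ⟨_, fun _ => b.equivFun.toLinearMap, Filter.Eventually.of_forall fun y =>
      ⟨b.equivFun.bijective, fun s => ⟨fun h i => h (b.coord i), fun h l => ?_⟩⟩⟩
    refine (RegularAt.sum (I := Finset.univ)
      fun i _ => (h i).mul (regularAt_const (l (b i)) y)).congr
      (Filter.Eventually.of_forall fun z => ?_)
    conv_rhs => rw [← b.sum_equivFun (s z)]
    simp only [map_sum, map_smul, smul_eq_mul, LinearEquiv.coe_coe]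

/-- The dual bundle. -/
abbrev dual (E : AlgVectorBundle V) : AlgVectorBundle V where
  fibre := fun x => Module.Dual ℂ (E.fibre x)
  Regular := fun η x => ∀ s : (∀ y, E.fibre y), E.Regular s x → RegularAt (fun y => η y (s y)) x
  locallyTrivial := fun x => by
    obtain ⟨r, e, b, h⟩ := E.exists_frame x
    have key : ∀ y, Function.Bijective (e y) → (∀ i, e y (b i y) = Pi.single i 1) →
        ∀ w : E.fibre y, w = ∑ i, e y w i • b i y := by
      intro y h1 h2 w
      apply h1.1
      rw [map_sum]
      simp_rw [map_smul, h2]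
      exact pi_eq_sum_univ' (e y w)
    refine ⟨r, fun y => LinearMap.pi fun i => Module.Dual.eval ℂ _ (b i y), ?_⟩
    filter_upwards [h, eventually_eventually_nhds.mpr h] with y hy hy2
    obtain ⟨h1, h2, h3, h4⟩ := hy
    refine ⟨⟨?_, ?_⟩, fun η => ⟨fun H i => H (b i) (h4 i), fun H s hs => ?_⟩⟩
    · intro η θ hηθ
      ext w
      rw [key y h1 h3 w, map_sum, map_sum]
      refine Finset.sum_congr rfl fun i _ => ?_
      rw [map_smul, map_smul]
      congr 1
      exact congrFun hηθ i
    · intro c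
      refine ⟨(∑ i, c i • LinearMap.proj i) ∘ₗ e y, ?_⟩
      ext i
      simp [h3, Pi.single_apply]
    · refine (RegularAt.sum (I := Finset.univ)
        fun i _ => ((h2 s).mp hs i).mul (H i)).congr ?_
      filter_upwards [hy2] with z hz
      conv_rhs => rw [key z hz.1 hz.2.2.1 (s z)]
      simp

theorem eventually_exists_dual_ne_zero (x : ℙ ℂ V) :
    ∃ l : Module.Dual ℂ V, ∀ᶠ y in 𝓝 x, l y.rep ≠ 0 := by
  obtain ⟨l, hl⟩ := Module.Projective.exists_dual_ne_zero ℂ x.rep_nonzero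
  exact ⟨l, eventually_apply_ne_zero l hl⟩

/-- The tautological line bundle `𝒪(-1)`: its fibre at the point `x` is the line `x` itself. -/
abbrev tautological (V : Type u) [AddCommGroup V] [Module ℂ V] : AlgVectorBundle V where
  fibre := fun x => x.submodule
  Regular := fun s x => ∀ l : Module.Dual ℂ V, RegularAt (fun y => l (s y : V)) x
  locallyTrivial := fun x => by
    obtain ⟨l, hl⟩ := eventually_exists_dual_ne_zero x
    have key : ∀ y : ℙ ℂ V, l y.rep ≠ 0 → ∀ w : y.submodule,
        (w : V) = (l w / l y.rep) • y.rep := by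
      intro y hy w
      obtain ⟨a, ha⟩ := Submodule.mem_span_singleton.mp (y.submodule_eq.le w.2)
      rw [← ha, map_smul, smul_eq_mul, mul_div_cancel_right₀ _ hy]
    refine ⟨1, fun y => LinearMap.pi fun _ => l ∘ₗ y.submodule.subtype, ?_⟩
    filter_upwards [hl, eventually_eventually_nhds.mpr hl] with y hy hy2
    refine ⟨⟨?_, ?_⟩, fun s => ⟨fun h _ => h l, fun h m => ?_⟩⟩
    · intro w w' hww
      have : l (w : V) = l (w' : V) := congrFun hww 0
      ext
      rw [key y hy w, key y hy w', this]
    · intro c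
      refine ⟨(c 0 / l y.rep) • ⟨y.rep, y.submodule_eq.ge (Submodule.mem_span_singleton_self _)⟩, ?_⟩
      ext i
      fin_cases i
      simp [hy]
    · refine ((h 0).mul (regularAt_div m l hy)).congr ?_
      filter_upwards [hy2] with z hz
      conv_rhs => rw [key z hz (s z)]
      simp
      ring

/-- The line bundle `𝒪(1)`, dual to `𝒪(-1)`. -/
abbrev hyperplane (V : Type u) [AddCommGroup V] [Module ℂ V] : AlgVectorBundle V :=
  dual (tautological V)

/-- The linear map induced by a morphism of bundles between the fibres at `x`. -/
def fibreMap {E F : AlgVectorBundle V} (φ : E ⟶ F) (x : ℙ ℂ V) : E.fibre x →ₗ[ℂ] F.fibre x :=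
  Hom.app φ x

@[ext]
theorem hom_ext {E F : AlgVectorBundle V} {φ ψ : E ⟶ F} (h : ∀ x, fibreMap φ x = fibreMap ψ x) :
    φ = ψ :=
  Hom.ext (funext h)

/-- The constant morphism `M ⊗ 𝒪 → M' ⊗ 𝒪` given by a linear map. -/
def constHom (V : Type u) [AddCommGroup V] [Module ℂ V] {M M' : Type u} [AddCommGroup M]
    [Module ℂ M] [FiniteDimensional ℂ M] [AddCommGroup M'] [Module ℂ M'] [FiniteDimensional ℂ M']
    (f : M →ₗ[ℂ] M') : trivialBundle V M ⟶ trivialBundle V M' :=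
  Hom.mk (E := trivialBundle V M) (F := trivialBundle V M') (fun _ => f)
    fun _ _ hs l => hs (l ∘ₗ f)

/-- The canonical inclusion `g : 𝒪(-1) → V ⊗ 𝒪`. -/
def inclusion (V : Type u) [AddCommGroup V] [Module ℂ V] [FiniteDimensional ℂ V] :
    tautological V ⟶ trivialBundle V V :=
  Hom.mk (E := tautological V) (F := trivialBundle V V) (fun x => x.submodule.subtype)
    fun _ _ hs => hs

/-- The transpose `ᵀg : V* ⊗ 𝒪 → 𝒪(1)` of `g`: the restriction of linear forms to lines. -/
def inclusionTranspose (V : Type u) [AddCommGroup V] [Module ℂ V] [FiniteDimensional ℂ V] :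
    trivialBundle V (Module.Dual ℂ V) ⟶ hyperplane V :=
  Hom.mk (E := trivialBundle V (Module.Dual ℂ V)) (F := hyperplane V)
    (fun x => x.submodule.dualRestrict) fun η x hη s hs => by
      let b := Module.finBasis ℂ V
      refine (RegularAt.sum (I := Finset.univ) fun i _ =>
        (hη (Module.Dual.eval ℂ V (b i))).mul (hs (b.coord i))).congr
        (Filter.Eventually.of_forall fun z => ?_)
      have h : ∀ (θ : Module.Dual ℂ V) (w : V), ∑ i, θ (b i) * b.coord i w = θ w := fun θ w => by
        conv_rhs => rw [← b.sum_repr w, map_sum]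
        exact Finset.sum_congr rfl fun i _ => by
          rw [map_smul, smul_eq_mul, mul_comm, Module.Basis.coord_apply]
      exact h (η z) (z.submodule.subtype (s z))

/-! #### The cohomology of a complex of bundles -/

/-- The fibre `ker h / im g` of the cohomology of a complex `A → B → C`. (The quotient is wrapped in a
structure only to keep its definition folded.) -/
structure CohomologyFibre {A B C : AlgVectorBundle V} (g : A ⟶ B) (h : B ⟶ C) (x : ℙ ℂ V) :
    Type u where
  toQuotient : LinearMap.ker (fibreMap h x) ⧸
    (LinearMap.range (fibreMap g x)).submoduleOf (LinearMap.ker (fibreMap h x))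

namespace CohomologyFibre

variable {A B C : AlgVectorBundle V} (g : A ⟶ B) (h : B ⟶ C) (x : ℙ ℂ V)

/-- The fibre of the cohomology is the quotient `ker h / im g`. -/
def equivQuotient : CohomologyFibre g h x ≃ (LinearMap.ker (fibreMap h x) ⧸
    (LinearMap.range (fibreMap g x)).submoduleOf (LinearMap.ker (fibreMap h x))) where
  toFun := toQuotient
  invFun := mk
  left_inv := fun _ => rfl
  right_inv := fun _ => rfl

instance : AddCommGroup (CohomologyFibre g h x) := (equivQuotient g h x).addCommGroup

instance : Module ℂ (CohomologyFibre g h x) := (equivQuotient g h x).module ℂ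

/-- The projection `ker h → ker h / im g`. -/
def proj : LinearMap.ker (fibreMap h x) →ₗ[ℂ] CohomologyFibre g h x :=
  ((equivQuotient g h x).linearEquiv ℂ).symm.toLinearMap ∘ₗ Submodule.mkQ _

theorem proj_surjective : Function.Surjective (proj g h x) :=
  ((equivQuotient g h x).linearEquiv ℂ).symm.surjective.comp (Submodule.mkQ_surjective _)

theorem proj_eq_zero_iff (w : LinearMap.ker (fibreMap h x)) :
    proj g h x w = 0 ↔ (w : B.fibre x) ∈ LinearMap.range (fibreMap g x) := by
  rw [proj, LinearMap.comp_apply, LinearEquiv.coe_coe, LinearEquiv.map_eq_zero_iff,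
    Submodule.mkQ_apply, Submodule.Quotient.mk_eq_zero]
  exact Iff.rfl

variable {g h x}

/-- The linear map on `ker h / im g` induced by a linear map on `ker h` which vanishes on `im g`. -/
def lift {M : Type*} [AddCommGroup M] [Module ℂ M] (φ : LinearMap.ker (fibreMap h x) →ₗ[ℂ] M)
    (hφ : ∀ w : LinearMap.ker (fibreMap h x), (w : B.fibre x) ∈ LinearMap.range (fibreMap g x) →
      φ w = 0) : CohomologyFibre g h x →ₗ[ℂ] M :=
  Submodule.liftQ _ φ (fun w hw => hφ w hw) ∘ₗ ((equivQuotient g h x).linearEquiv ℂ).toLinearMap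

theorem lift_proj {M : Type*} [AddCommGroup M] [Module ℂ M]
    (φ : LinearMap.ker (fibreMap h x) →ₗ[ℂ] M)
    (hφ : ∀ w : LinearMap.ker (fibreMap h x), (w : B.fibre x) ∈ LinearMap.range (fibreMap g x) →
      φ w = 0) (w : LinearMap.ker (fibreMap h x)) : lift φ hφ (proj g h x w) = φ w :=
  rfl

end CohomologyFibre

/-- A section of `ker h / im g` is regular at `x` if near `x` it is represented by a regular section
of `B` with values in the kernel of `h`. -/
def cohomologyRegular {A B C : AlgVectorBundle V} (g : A ⟶ B) (h : B ⟶ C)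
    (s : ∀ x, CohomologyFibre g h x) (x : ℙ ℂ V) : Prop :=
  ∃ σ : ∀ y, B.fibre y, B.Regular σ x ∧ ∀ᶠ y in 𝓝 x, ∃ hy : σ y ∈ LinearMap.ker (fibreMap h y),
    s y = CohomologyFibre.proj g h y ⟨σ y, hy⟩

/-! #### Inverse images -/

section Pullback

variable {W X : Type u} [AddCommGroup W] [Module ℂ W] [AddCommGroup X] [Module ℂ X]

/-- The inverse image `h^* E`. Its fibre at `x` is the fibre of `E` at `h x`, and its regular
sections are locally the linear combinations, with regular functions as coefficients, of the inverse
images of regular sections of `E`. -/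
abbrev pullbackObj (h : RegularMap V W) (E : AlgVectorBundle W) : AlgVectorBundle V where
  fibre := fun x => E.fibre (h.toFun x)
  Regular := fun t x => ∃ (ι : Type) (_ : Fintype ι) (a : ι → ℙ ℂ V → ℂ)
    (s : ι → ∀ y, E.fibre y), (∀ i, RegularAt (a i) x) ∧ (∀ i, E.Regular (s i) (h.toFun x)) ∧
      ∀ᶠ y in 𝓝 x, t y = ∑ i, a i y • s i (h.toFun y)
  locallyTrivial := fun x => by
    obtain ⟨r, e, b, H⟩ := E.exists_frame (h.toFun x)
    have H' := h.continuous_toFun.continuousAt.eventually H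
    refine ⟨r, fun y => e (h.toFun y), ?_⟩
    filter_upwards [H', eventually_eventually_nhds.mpr H'] with y hy hy2
    obtain ⟨h1, h2, h3, h4⟩ := hy
    refine ⟨h1, fun t => ⟨?_, fun ht => ?_⟩⟩
    · rintro ⟨ι, _, a, s, ha, hs, hts⟩ i
      refine (RegularAt.sum (I := Finset.univ) fun j _ =>
        (ha j).mul (h.regular_comp _ _ ((h2 (s j)).mp (hs j) i))).congr ?_
      filter_upwards [hts] with z hz
      rw [hz]
      simp
    · refine ⟨Fin r, inferInstance, fun i z => e (h.toFun z) (t z) i, b, ht, h4, ?_⟩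
      filter_upwards [hy2] with z hz
      apply hz.1.1
      rw [map_sum]
      simp_rw [map_smul, hz.2.2.1]
      exact pi_eq_sum_univ' (e (h.toFun z) (t z))

/-- The inverse image functor `h^*`. -/
abbrev pullback (h : RegularMap V W) : AlgVectorBundle W ⥤ AlgVectorBundle V where
  obj := pullbackObj h
  map {E F} φ := Hom.mk (E := pullbackObj h E) (F := pullbackObj h F)
    (fun x => fibreMap φ (h.toFun x)) fun t x ht => by
      obtain ⟨ι, _, a, s, ha, hs, hts⟩ := ht
      refine ⟨ι, inferInstance, a, fun i y => fibreMap φ y (s i y), ha,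
        fun i => Hom.map_regular φ _ _ (hs i), ?_⟩
      filter_upwards [hts] with z hz
      have h2 : fibreMap φ (h.toFun z) (t z) =
          ∑ i, a i z • fibreMap φ (h.toFun z) (s i (h.toFun z)) := by
        rw [show t z = ∑ i, a i z • s i (h.toFun z) from hz, map_sum]
        exact Finset.sum_congr rfl fun i _ => map_smul _ _ _
      exact h2

/-- The canonical isomorphism `k^* h^* E ≅ (h ∘ k)^* E`, which is the identity on the fibres. -/
def pullbackComp (h : RegularMap W X) (k : RegularMap V W) (E : AlgVectorBundle X) :
    (pullback k).obj ((pullback h).obj E) ≅ (pullback (h.comp k)).obj E where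
  hom := Hom.mk (E := (pullback k).obj ((pullback h).obj E)) (F := (pullback (h.comp k)).obj E)
    (fun _ => LinearMap.id) fun t x ht => by
      obtain ⟨ι, _, a, s, ha, hs, hts⟩ := ht
      choose κ hκ a' s' ha' hs' hts' using hs
      refine ⟨Σ i, κ i, inferInstance, fun p z => a p.1 z * a' p.1 p.2 (k.toFun z),
        fun p => s' p.1 p.2, fun p => (ha p.1).mul (k.regular_comp _ _ (ha' p.1 p.2)),
        fun p => hs' p.1 p.2, ?_⟩
      have hts'' : ∀ᶠ z in 𝓝 x, ∀ i, s i (k.toFun z) =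
          ∑ j, a' i j (k.toFun z) • s' i j (h.toFun (k.toFun z)) :=
        Filter.eventually_all.mpr fun i => k.continuous_toFun.continuousAt.eventually (hts' i)
      filter_upwards [hts, hts''] with z hz hz2
      have h2 : ∑ i, a i z • s i (k.toFun z) = ∑ p : (Σ i, κ i),
          (a p.1 z * a' p.1 p.2 (k.toFun z)) •
            (show E.fibre (h.toFun (k.toFun z)) from s' p.1 p.2 (h.toFun (k.toFun z))) := by
        rw [Fintype.sum_sigma]
        refine Finset.sum_congr rfl fun i _ => ?_
        refine (congrArg (a i z • ·) (hz2 i)).trans ?_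
        refine (Finset.smul_sum (N := E.fibre (h.toFun (k.toFun z)))).trans ?_
        exact Finset.sum_congr rfl fun j _ => smul_smul _ _ _
      exact hz.trans h2
  inv := Hom.mk (E := (pullback (h.comp k)).obj E) (F := (pullback k).obj ((pullback h).obj E))
    (fun _ => LinearMap.id) fun t x ht => by
      obtain ⟨ι, _, a, s, ha, hs, hts⟩ := ht
      refine ⟨ι, inferInstance, a, fun i y => s i (h.toFun y), ha, fun i => ?_, hts⟩
      exact ⟨Unit, inferInstance, fun _ _ => 1, fun _ => s i, fun _ => regularAt_const 1 _,
        fun _ => hs i, Filter.Eventually.of_forall fun z => by simp⟩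

/-- The canonical isomorphism between the inverse images by equal maps. -/
def pullbackCongr {h k : RegularMap V W} (H : h = k) (E : AlgVectorBundle W) :
    (pullback h).obj E ≅ (pullback k).obj E :=
  eqToIso (by rw [H])

end Pullback

end AlgVectorBundle

/-! ### Null correlation bundles -/

open AlgVectorBundle

section NullCorrelationBundle

variable {V : Type u} [AddCommGroup V] [Module ℂ V]

/-- An antisymmetric isomorphism `f : V → V*`. -/
@[ext]
structure SkewIso (V : Type u) [AddCommGroup V] [Module ℂ V] where
  toEquiv : V ≃ₗ[ℂ] Module.Dual ℂ V
  alternating : ∀ u, toEquiv u u = 0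

theorem SkewIso.skew (f : SkewIso V) (u v : V) : f.toEquiv u v = - f.toEquiv v u := by
  have h := f.alternating (u + v)
  simp only [map_add, LinearMap.add_apply, f.alternating, zero_add, add_zero] at h
  exact eq_neg_of_add_eq_zero_right h

/-- The antisymmetric isomorphism `ᵀκ ∘ f ∘ κ`. -/
def SkewIso.conj (f : SkewIso V) (κ : V ≃ₗ[ℂ] V) : SkewIso V where
  toEquiv := (κ.trans f.toEquiv).trans κ.dualMap
  alternating := fun u => f.alternating (κ u)

variable [FiniteDimensional ℂ V]

/-- The second map `ᵀg ∘ f : V ⊗ 𝒪 → 𝒪(1)` of the monad `𝒪(-1) → V ⊗ 𝒪 → 𝒪(1)` of `f`. -/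
def monadMap (f : SkewIso V) : trivialBundle V V ⟶ hyperplane V :=
  constHom V f.toEquiv.toLinearMap ≫ inclusionTranspose V

theorem mem_ker_monadMap (f : SkewIso V) (x : ℙ ℂ V) (u : V) :
    u ∈ LinearMap.ker (fibreMap (monadMap f) x) ↔ f.toEquiv u x.rep = 0 := by
  change x.submodule.dualRestrict (f.toEquiv u) = 0 ↔ _
  constructor
  · intro h
    exact LinearMap.congr_fun h
      ⟨x.rep, x.submodule_eq.ge (Submodule.mem_span_singleton_self _)⟩
  · intro h
    ext w
    obtain ⟨a, ha⟩ := Submodule.mem_span_singleton.mp (x.submodule_eq.le w.2)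
    change f.toEquiv u (w : V) = 0
    rw [← ha, map_smul, h, smul_zero]

/-- The sequence `𝒪(-1) → V ⊗ 𝒪 → 𝒪(1)` is a monad: a complex whose first map is injective, and
whose second map is surjective, on every fibre. -/
theorem isMonad (f : SkewIso V) (x : ℙ ℂ V) :
    fibreMap (monadMap f) x ∘ₗ fibreMap (inclusion V) x = 0 ∧
      Function.Injective (fibreMap (inclusion V) x) ∧
      Function.Surjective (fibreMap (monadMap f) x) := by
  refine ⟨?_, Subtype.val_injective, ?_⟩
  · refine LinearMap.ext fun w => ?_
    refine (mem_ker_monadMap f x (x.submodule.subtype w)).mpr ?_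
    obtain ⟨a, ha⟩ := Submodule.mem_span_singleton.mp (x.submodule_eq.le (Subtype.property w))
    change f.toEquiv w.1 x.rep = 0
    rw [← ha, map_smul, LinearMap.smul_apply, f.alternating, smul_zero]
  · exact (Subspace.dualRestrict_surjective (W := x.submodule)).comp f.toEquiv.surjective

/-- Local triviality of the cohomology of the monad. -/
theorem cohomology_locallyTrivial (f : SkewIso V) (x : ℙ ℂ V) :
    ∃ (r : ℕ) (e : ∀ y, CohomologyFibre (inclusion V) (monadMap f) y →ₗ[ℂ] (Fin r → ℂ)),
      ∀ᶠ y in 𝓝 x, Function.Bijective (e y) ∧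
        ∀ s : (∀ z, CohomologyFibre (inclusion V) (monadMap f) z),
          cohomologyRegular (inclusion V) (monadMap f) s y ↔
            ∀ i, RegularAt (fun z => e z (s z) i) y := by
  obtain ⟨w₀, hw₀⟩ : ∃ w₀, f.toEquiv x.rep w₀ ≠ 0 := by
    by_contra! h
    exact x.rep_nonzero (f.toEquiv.map_eq_zero_iff.mp (LinearMap.ext h))
  -- `m v = f(v, w₀)` is the linear form whose nonvanishing defines the neighbourhood
  let m : Module.Dual ℂ V := f.toEquiv.toLinearMap.flip w₀
  have hm : ∀ v, m v = f.toEquiv v w₀ := fun v => rfl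
  have hmw : m w₀ = 0 := f.alternating w₀
  let v₀ := x.rep
  have hU : ∀ᶠ y in 𝓝 x, m y.rep ≠ 0 := eventually_apply_ne_zero m hw₀
  -- `K` is the orthogonal complement of the plane spanned by `v₀` and `w₀`
  let K : Submodule ℂ V := LinearMap.ker (f.toEquiv.toLinearMap.flip v₀) ⊓ LinearMap.ker m
  have hKm : ∀ u : V, u ∈ K ↔ f.toEquiv u v₀ = 0 ∧ m u = 0 := fun u => Iff.rfl
  have hmv : m v₀ ≠ 0 := hw₀
  have hwv : f.toEquiv w₀ v₀ = - m v₀ := f.skew _ _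
  let p : V →ₗ[ℂ] V := LinearMap.id - (m v₀)⁻¹ • m.smulRight v₀ +
    (m v₀)⁻¹ • (f.toEquiv.toLinearMap.flip v₀).smulRight w₀
  have hp : ∀ u, p u = u - ((m v₀)⁻¹ * m u) • v₀ + ((m v₀)⁻¹ * f.toEquiv u v₀) • w₀ := by
    intro u
    simp [p, smul_smul]
  have hpK : ∀ u, p u ∈ K := by
    intro u
    rw [hKm, hp]
    simp only [map_add, map_sub, map_smul, LinearMap.add_apply, LinearMap.sub_apply,
      LinearMap.smul_apply, f.alternating, hwv, hmw, smul_eq_mul]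
    constructor <;> field_simp <;> ring
  have hpk : ∀ u ∈ K, p u = u := by
    intro u hu
    rw [hKm] at hu
    rw [hp, hu.1, hu.2]
    simp
  have hpw : p w₀ = 0 := by
    rw [hp, hmw, hwv]
    simp [hmv]
  let P : V →ₗ[ℂ] K := p.codRestrict K hpK
  let b := Module.finBasis ℂ K
  -- the vector `q y u` is congruent to `u` modulo the line `y`, and is annihilated by `m`
  let q : ℙ ℂ V → V →ₗ[ℂ] V := fun y =>
    (m y.rep)⁻¹ • (m y.rep • LinearMap.id - m.smulRight y.rep)
  have hq : ∀ y, m y.rep ≠ 0 → ∀ u, q y u = u - (m u / m y.rep) • y.rep := by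
    intro y hy u
    simp [q, smul_sub, smul_smul, hy, div_eq_inv_mul]
  have hqy : ∀ y, q y y.rep = 0 := by
    intro y
    simp [q]
  let e' : ∀ y, V →ₗ[ℂ] (Fin (Module.finrank ℂ K) → ℂ) := fun y =>
    b.equivFun.toLinearMap ∘ₗ P ∘ₗ q y
  let e : ∀ y, CohomologyFibre (inclusion V) (monadMap f) y →ₗ[ℂ]
      (Fin (Module.finrank ℂ K) → ℂ) := fun y =>
    CohomologyFibre.lift (e' y ∘ₗ (LinearMap.ker (fibreMap (monadMap f) y)).subtype) (by
      rintro ⟨u, hu⟩ ⟨w, hw⟩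
      obtain ⟨c, hc⟩ := Submodule.mem_span_singleton.mp (y.submodule_eq.le (Subtype.property w))
      have hu2 : u = c • y.rep := hw.symm.trans hc.symm
      change e' y u = 0
      rw [hu2, map_smul]
      simp [e', hqy])
  have he : ∀ y (u : LinearMap.ker (fibreMap (monadMap f) y)),
      e y (CohomologyFibre.proj _ _ y u) = b.equivFun (P (q y u.1)) := fun y u => rfl
  -- the lift of `k ∈ K` to a vector orthogonal to the line `y`
  let L : ℙ ℂ V → V → V := fun y k => k - (f.toEquiv y.rep k / m y.rep) • w₀
  have hLker : ∀ y, m y.rep ≠ 0 → ∀ k, L y k ∈ LinearMap.ker (fibreMap (monadMap f) y) := by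
    intro y hy k
    refine (mem_ker_monadMap f y _).mpr ?_
    rw [f.skew]
    simp only [L, map_sub, map_smul, smul_eq_mul]
    rw [← hm, div_mul_cancel₀ _ hy, sub_self, neg_zero]
  have heL : ∀ y (hy : m y.rep ≠ 0) (k : K),
      P (q y (L y k)) = k := by
    intro y hy k
    have hk := (hKm _).mp k.2
    apply Subtype.ext
    change p (q y (L y k)) = k
    have h0 : m (L y k) = 0 := by
      simp only [L, map_sub, map_smul, hk.2, hmw, smul_zero, sub_zero]
    rw [hq y hy, h0, zero_div, zero_smul, sub_zero]
    simp only [L, map_sub, map_smul, hpw, smul_zero, sub_zero]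
    exact hpk _ k.2
  have hline : ∀ y, m y.rep ≠ 0 → ∀ u : V, f.toEquiv u y.rep = 0 → p (q y u) = 0 →
      u = (m u / m y.rep) • y.rep := by
    intro y hy u hu2 h1
    have hqu := hq y hy u
    set u' := q y u with hu'
    have h2 : m u' = 0 := by
      rw [hqu, map_sub, map_smul, smul_eq_mul, div_mul_cancel₀ _ hy, sub_self]
    have h3 : f.toEquiv u' y.rep = 0 := by
      rw [hqu, map_sub, map_smul, LinearMap.sub_apply, LinearMap.smul_apply, f.alternating, hu2]
      simp
    rw [hp, h2, mul_zero, zero_smul, sub_zero] at h1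
    have h4 : u' = -((m v₀)⁻¹ * f.toEquiv u' v₀) • w₀ := by
      rw [neg_smul]
      exact eq_neg_of_add_eq_zero_left h1
    generalize -((m v₀)⁻¹ * f.toEquiv u' v₀) = c at h4
    have h5 : u' = 0 := by
      rw [h4, map_smul, LinearMap.smul_apply, f.skew, ← hm, smul_eq_mul] at h3
      have hc : c = 0 := by simpa [hy] using h3
      rw [h4, hc, zero_smul]
    rw [h5] at hqu
    exact sub_eq_zero.mp hqu.symm
  have hinj : ∀ y, m y.rep ≠ 0 → Function.Injective (e y) := by
    intro y hy
    rw [injective_iff_map_eq_zero]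
    intro z hz
    obtain ⟨⟨u, hu⟩, rfl⟩ := CohomologyFibre.proj_surjective _ _ _ z
    rw [he] at hz
    have h6 := hline y hy u ((mem_ker_monadMap f y u).mp hu)
      (congrArg Subtype.val (b.equivFun.map_eq_zero_iff.mp hz))
    refine (CohomologyFibre.proj_eq_zero_iff _ _ _ _).mpr ⟨⟨u, y.submodule_eq.ge ?_⟩, rfl⟩
    exact Submodule.mem_span_singleton.mpr ⟨_, h6.symm⟩
  refine ⟨_, e, ?_⟩
  filter_upwards [hU, eventually_eventually_nhds.mpr hU] with y hy hy2
  refine ⟨⟨hinj y hy, fun c => ?_⟩, fun s => ⟨?_, fun hs => ?_⟩⟩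
  · refine ⟨CohomologyFibre.proj _ _ y ⟨L y (b.equivFun.symm c), hLker y hy _⟩, ?_⟩
    rw [he]
    change b.equivFun (P (q y (L y _))) = c
    rw [heL y hy, LinearEquiv.apply_symm_apply]
  · rintro ⟨σ, hσ, hsσ⟩ i
    let l : Module.Dual ℂ V := b.coord i ∘ₗ P
    refine (((hσ l).sub ((hσ m).mul (regularAt_div l m hy)))).congr ?_
    filter_upwards [hsσ, hy2] with z hz hz2
    obtain ⟨hz, hsz⟩ := hz
    rw [hsz, he]
    have h1 : ∀ u : V, l u - m u * (l z.rep / m z.rep) = l (q z u) := fun u => by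
      rw [hq z hz2, map_sub, map_smul, smul_eq_mul]
      ring
    exact h1 (σ z)
  · let F : ∀ z, Fin (Module.finrank ℂ K) → ℂ := fun z => e z (s z)
    let k : ℙ ℂ V → K := fun z => b.equivFun.symm (F z)
    have hk : ∀ z, (k z : V) = ∑ i, F z i • (b i : V) := by
      intro z
      simp [k, Module.Basis.equivFun_symm_apply]
    refine ⟨fun z => L z (k z), fun l => ?_, ?_⟩
    · have h1 : RegularAt (fun z => ∑ i, F z i * l (b i)) y :=
        RegularAt.sum fun i _ => (hs i).mul (regularAt_const _ _)
      have h2 : RegularAt (fun z => ∑ i, F z i *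
          ((f.toEquiv.toLinearMap.flip (b i : V)) z.rep / m z.rep)) y :=
        RegularAt.sum fun i _ => (hs i).mul (regularAt_div _ m hy)
      refine (h1.sub (h2.mul (regularAt_const (l w₀) y))).congr
        (Filter.Eventually.of_forall fun z => ?_)
      change _ = l (L z (k z))
      simp only [L, hk, map_sub, map_sum, map_smul, smul_eq_mul, Finset.sum_div, mul_div_assoc,
        LinearMap.flip_apply, LinearEquiv.coe_coe]
    · filter_upwards [hy2] with z hz
      refine ⟨hLker z hz _, hinj z hz ?_⟩
      rw [he]
      change F z = b.equivFun (P (q z (L z (k z))))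
      rw [heL z hz]
      exact (b.equivFun.apply_symm_apply _).symm

/-- The classical null correlation bundle `N(f)`: the cohomology of the monad
`𝒪(-1) → V ⊗ 𝒪 → 𝒪(1)` with maps `g` and `ᵀg ∘ f`. -/
abbrev nullCorrelationBundle (f : SkewIso V) : AlgVectorBundle V where
  fibre := CohomologyFibre (inclusion V) (monadMap f)
  Regular := cohomologyRegular (inclusion V) (monadMap f)
  locallyTrivial := cohomology_locallyTrivial f

/-- The class in the fibre of `N(f)` at `x` of a vector in the kernel of `ᵀg ∘ f` at `x`. -/
def nullClass (f : SkewIso V) (x : ℙ ℂ V) (w : LinearMap.ker (fibreMap (monadMap f) x)) :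
    (nullCorrelationBundle f).fibre x :=
  CohomologyFibre.proj _ _ x w

end NullCorrelationBundle

/-- The antidiagonal antisymmetric matrix with entries `-r_0, …, -r_n, r_n, …, r_0`, from the upper
right corner to the lower left corner. -/
def specialMatrix {n : ℕ} (r : Fin (n + 1) → ℂ) :
    Matrix (Fin (2 * n + 2)) (Fin (2 * n + 2)) ℂ :=
  fun i j =>
    if j = i.rev then
      if h : (i : ℕ) < n + 1 then - r ⟨i, h⟩ else r ⟨2 * n + 1 - i, by omega⟩
    else 0

section Action

variable {V : Type u} [AddCommGroup V] [Module ℂ V] {m : ℕ}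

/-- The linear automorphism `σ(t)` of `V` with the diagonal matrix `(t^(a_0), …, t^(a_(m-1)))` in
the basis `b`. -/
def diagAction (b : Module.Basis (Fin m) ℂ V) (a : Fin m → ℤ) (t : ℂˣ) : V ≃ₗ[ℂ] V :=
  b.equiv (b.unitsSMul fun i => t ^ a i) (Equiv.refl _)

theorem diagAction_apply (b : Module.Basis (Fin m) ℂ V) (a : Fin m → ℤ) (t : ℂˣ) (i : Fin m) :
    diagAction b a t (b i) = ((t : ℂ) ^ a i) • b i := by
  simp [diagAction, Module.Basis.unitsSMul_apply, Units.smul_def]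

/-- The regular map `σ̄(t)` of `ℙ(V)` to itself induced by `σ(t)`. -/
def projAction (b : Module.Basis (Fin m) ℂ V) (a : Fin m → ℤ) (t : ℂˣ) : RegularMap V V :=
  projMap (diagAction b a t)

theorem projAction_mul (b : Module.Basis (Fin m) ℂ V) (a : Fin m → ℤ) (t₁ t₂ : ℂˣ) :
    (projAction b a t₁).comp (projAction b a t₂) = projAction b a (t₁ * t₂) := by
  rw [projAction, projAction, projAction, ← projMap_trans]
  congr 1
  refine LinearEquiv.toLinearMap_injective (b.ext fun i => ?_)
  simp [diagAction_apply, mul_zpow, smul_smul, mul_comm]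

end Action

end

end NullCorrelation

open NullCorrelation NullCorrelation.AlgVectorBundle

/-! The fibre of N(f) at a point x is x^⊥/x, where x^⊥ is the orthogonal of the line x for the
alternating form f(u,v) = f(u)(v).

The hard direction of the first statement recovers f, up to a scalar, from the restrictions of N(f)
to lines ℙ(W), with W spanned by independent vectors u and v. If f(u,v) = 0, the constant vector u
lies in y^⊥ for every y in ℙ(W), and gives a section along ℙ(W) which vanishes at [u] but not at [v]
(`sectionRegularAlong_nullSection`). If f(u,v) ≠ 0, then V = W ⊕ W^⊥ and N(f) restricted to ℙ(W) is
the trivial bundle with fibre W^⊥, so a section which vanishes at [u] also vanishes at [v]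
(`eq_zero_of_sectionRegularAlong`). This rests on the constancy of regular functions on a projective
line, which is deduced from Liouville's theorem (`RegularAlong.apply_eq`). Hence an isomorphism
preserves the isotropic lines (`isotropic_of_hom`), and two forms with f₁(u,v) = 0 whenever f₂(u,v)
= 0 are proportional (`exists_eq_smul_of_isotropic`).

All the isomorphisms to be constructed are instances of [w] ↦ [κ w] from x^⊥/x to y^⊥/y, for a
linear automorphism κ which maps x into y and x^⊥ into y^⊥ (`FibreCompat`, `fibreTransport`). With κ
the identity this settles proportional forms (`isoOfSmul`). With κ⁻¹ it gives κ̄^*N(f) ≃ N(f')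
whenever ᵀκ∘f∘κ is a nonzero multiple of f' (`pullbackIso`), which is the second statement for
multiple 1. In the third statement σ(t) multiplies f by t^d (`apply_diagAction`), so f' = f is
allowed. Since the resulting maps send [σ(t)w] to [w], the cocycle rule reduces to the
multiplicativity of σ (`pullbackComp_cocycle`). -/

namespace NullCorrelation

noncomputable section

/-! ### Transport of fibres and inverse images of null correlation bundles -/

section Maps

variable {V : Type u} [AddCommGroup V] [Module ℂ V]

/-- This closure property and the next three follow by reading sections in a local trivialisation.
They are needed because a regular section of an inverse image is, locally, a combination of inverse
images of sections with regular coefficients. -/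
theorem regular_add {E : AlgVectorBundle V} {s t : ∀ y, E.fibre y} {x : ℙ ℂ V}
    (hs : E.Regular s x) (ht : E.Regular t x) : E.Regular (fun y => s y + t y) x := by
  obtain ⟨r, e, he⟩ := E.locallyTrivial x
  have hx := he.self_of_nhds.2
  rw [hx] at hs ht ⊢
  exact fun i => ((hs i).add (ht i)).congr (Filter.Eventually.of_forall fun y => by simp)

theorem regular_smul {E : AlgVectorBundle V} {s : ∀ y, E.fibre y} {a : ℙ ℂ V → ℂ} {x : ℙ ℂ V}
    (ha : RegularAt a x) (hs : E.Regular s x) : E.Regular (fun y => a y • s y) x := by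
  obtain ⟨r, e, he⟩ := E.locallyTrivial x
  have hx := he.self_of_nhds.2
  rw [hx] at hs ⊢
  exact fun i => (ha.mul (hs i)).congr (Filter.Eventually.of_forall fun y => by simp)

theorem regular_zero (E : AlgVectorBundle V) (x : ℙ ℂ V) : E.Regular (fun _ => 0) x := by
  obtain ⟨r, e, he⟩ := E.locallyTrivial x
  rw [he.self_of_nhds.2]
  exact fun i => (regularAt_const 0 x).congr (Filter.Eventually.of_forall fun y => by simp)

theorem regular_sum {E : AlgVectorBundle V} {ι : Type*} {I : Finset ι} {s : ι → ∀ y, E.fibre y}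
    {x : ℙ ℂ V} (hs : ∀ i ∈ I, E.Regular (s i) x) : E.Regular (fun y => ∑ i ∈ I, s i y) x := by
  classical
  induction I using Finset.induction_on with
  | empty => simpa using regular_zero E x
  | insert i I hi ih =>
    simp only [Finset.sum_insert hi]
    exact regular_add (hs i (by simp)) (ih fun j hj => hs j (by simp [hj]))

theorem projMap_symm_projMap (κ : V ≃ₗ[ℂ] V) (x : ℙ ℂ V) :
    (projMap κ.symm).toFun ((projMap κ).toFun x) = x := by
  induction x using Projectivization.ind with
  | h v hv => simp [projMap, Projectivization.map_mk]

/-- A linear automorphism `κ` of `V` maps the line `x` to the line `y` and the orthogonal of `x` for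
`f` to the orthogonal of `y` for `f'`. -/
def FibreCompat (f f' : SkewIso V) (κ : V ≃ₗ[ℂ] V) (x y : ℙ ℂ V) : Prop :=
  (∃ c : ℂ, κ x.rep = c • y.rep) ∧ ∀ w, f.toEquiv w x.rep = 0 → f'.toEquiv (κ w) y.rep = 0

/-- A similitude carries orthogonals to orthogonals; the factors a and c are nonzero and can be
cancelled. The three lemmas below are the instances for κ and its inverse that `pullbackIso` uses.
-/
theorem FibreCompat.of_scale {f f' : SkewIso V} {κ : V ≃ₗ[ℂ] V} {a : ℂ} (ha : a ≠ 0)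
    (h : ∀ u v, f.toEquiv u v = a * f'.toEquiv (κ u) (κ v)) {x y : ℙ ℂ V}
    (hxy : ∃ c : ℂ, c ≠ 0 ∧ κ x.rep = c • y.rep) : FibreCompat f f' κ x y := by
  obtain ⟨c, hc, hxy⟩ := hxy
  refine ⟨⟨c, hxy⟩, fun w hw => ?_⟩
  rw [h, hxy, map_smul, smul_eq_mul] at hw
  simpa [ha, hc] using hw

theorem FibreCompat.symm_projMap {f f' : SkewIso V} {κ : V ≃ₗ[ℂ] V} {a : ℂ} (ha : a ≠ 0)
    (h : ∀ u v, f.toEquiv (κ u) (κ v) = a * f'.toEquiv u v) (y : ℙ ℂ V) :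
    FibreCompat f f' κ.symm ((projMap κ).toFun y) y :=
  .of_scale ha (fun u v => by simp [← h]) (by
    obtain ⟨c, hc, hy⟩ := map_rep κ y
    exact ⟨c, hc, (κ.symm_apply_eq).mpr (hy.trans (map_smul κ _ _).symm)⟩)

theorem FibreCompat.projMap {f f' : SkewIso V} {κ : V ≃ₗ[ℂ] V} {a : ℂ} (ha : a ≠ 0)
    (h : ∀ u v, f.toEquiv (κ u) (κ v) = a * f'.toEquiv u v) (y : ℙ ℂ V) :
    FibreCompat f' f κ y ((projMap κ).toFun y) :=
  .of_scale (inv_ne_zero ha) (fun u v => by simp [h, ha]) (by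
    obtain ⟨c, hc, hy⟩ := map_rep κ y
    exact ⟨c⁻¹, inv_ne_zero hc, ((inv_smul_eq_iff₀ hc).mpr hy).symm⟩)

theorem FibreCompat.projMap_symm {f f' : SkewIso V} {κ : V ≃ₗ[ℂ] V} {a : ℂ} (ha : a ≠ 0)
    (h : ∀ u v, f.toEquiv (κ u) (κ v) = a * f'.toEquiv u v) (y : ℙ ℂ V) :
    FibreCompat f' f κ ((NullCorrelation.projMap κ.symm).toFun y) y := by
  have := FibreCompat.projMap ha h ((NullCorrelation.projMap κ.symm).toFun y)
  rwa [show (NullCorrelation.projMap κ).toFun ((NullCorrelation.projMap κ.symm).toFun y) = y from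
    projMap_symm_projMap κ.symm y] at this

variable [FiniteDimensional ℂ V]

theorem mem_range_inclusion (x : ℙ ℂ V) (u : V) :
    u ∈ LinearMap.range (fibreMap (inclusion V) x) ↔ ∃ c : ℂ, u = c • x.rep := by
  constructor
  · rintro ⟨w, hw⟩
    obtain ⟨c, hc⟩ := Submodule.mem_span_singleton.mp (x.submodule_eq.le (Subtype.property w))
    exact ⟨c, hw.symm.trans hc.symm⟩
  · rintro ⟨c, hc⟩
    exact ⟨⟨u, x.submodule_eq.ge (Submodule.mem_span_singleton.mpr ⟨c, hc.symm⟩)⟩, rfl⟩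

theorem nullClass_eq_zero_iff (f : SkewIso V) (x : ℙ ℂ V)
    (w : LinearMap.ker (fibreMap (monadMap f) x)) :
    nullClass f x w = 0 ↔ ∃ c : ℂ, (w.1 : V) = c • x.rep :=
  (CohomologyFibre.proj_eq_zero_iff _ _ _ _).trans (mem_range_inclusion x w.1)

/-- The map `[w] ↦ [κ w]` between fibres of null correlation bundles. -/
def fibreTransport {f f' : SkewIso V} {κ : V ≃ₗ[ℂ] V} {x y : ℙ ℂ V}
    (h : FibreCompat f f' κ x y) :
    (nullCorrelationBundle f).fibre x →ₗ[ℂ] (nullCorrelationBundle f').fibre y :=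
  CohomologyFibre.lift
    (CohomologyFibre.proj (inclusion V) (monadMap f') y ∘ₗ
      κ.toLinearMap.restrict (p := LinearMap.ker (fibreMap (monadMap f) x))
        (q := LinearMap.ker (fibreMap (monadMap f') y)) fun w hw =>
          (mem_ker_monadMap f' y _).mpr (h.2 w ((mem_ker_monadMap f x w).mp hw)))
    fun w hw => by
      obtain ⟨c, hc⟩ := (mem_range_inclusion x w.1).mp hw
      obtain ⟨d, hd⟩ := h.1
      refine (nullClass_eq_zero_iff f' y _).mpr ⟨c * d, ?_⟩
      change κ w.1 = _
      rw [hc, map_smul, hd, smul_smul]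

theorem fibreTransport_nullClass {f f' : SkewIso V} {κ : V ≃ₗ[ℂ] V} {x y : ℙ ℂ V}
    (h : FibreCompat f f' κ x y) (w : LinearMap.ker (fibreMap (monadMap f) x))
    (w' : LinearMap.ker (fibreMap (monadMap f') y)) (hw : (w'.1 : V) = κ w.1) :
    fibreTransport h (nullClass f x w) = nullClass f' y w' := by
  obtain ⟨w', hw'⟩ := w'
  change w' = κ w.1 at hw
  subst hw
  rfl

theorem exists_nullClass {f : SkewIso V} {x : ℙ ℂ V} (z : (nullCorrelationBundle f).fibre x) :
    ∃ w, z = nullClass f x w := by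
  obtain ⟨w, hw⟩ := CohomologyFibre.proj_surjective _ _ _ z
  exact ⟨w, hw.symm⟩

theorem fibreTransport_fibreTransport {f f' : SkewIso V} {κ μ : V ≃ₗ[ℂ] V} {x y : ℙ ℂ V}
    (h : FibreCompat f f' κ x y) (h' : FibreCompat f' f μ y x) (hκ : ∀ w, μ (κ w) = w)
    (z : (nullCorrelationBundle f).fibre x) : fibreTransport h' (fibreTransport h z) = z := by
  obtain ⟨w, rfl⟩ := exists_nullClass z
  rw [fibreTransport_nullClass h w ⟨κ w.1, (mem_ker_monadMap f' y _).mpr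
    (h.2 w.1 ((mem_ker_monadMap f x w.1).mp w.2))⟩ rfl]
  exact fibreTransport_nullClass h' _ _ (hκ w.1).symm

/-- If `y ↦ x` is regular and fibrewise compatible with `κ`, transport along it preserves regular
sections. -/
theorem regular_fibreTransport {f f' : SkewIso V} {κ : V ≃ₗ[ℂ] V} (k : RegularMap V V)
    (h : ∀ y, FibreCompat f f' κ (k.toFun y) y) (s : ∀ x, (nullCorrelationBundle f).fibre x)
    (y : ℙ ℂ V) (hs : (nullCorrelationBundle f).Regular s (k.toFun y)) :
    (nullCorrelationBundle f').Regular (fun z => fibreTransport (h z) (s (k.toFun z))) y := by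
  obtain ⟨σ, hσ, hsσ⟩ := hs
  -- A local representative σ of the section is carried to κ ∘ σ ∘ k, which represents the
  -- transported section.
  refine ⟨fun z => κ (σ (k.toFun z)), fun l => k.regular_comp _ _ (hσ (l ∘ₗ κ.toLinearMap)), ?_⟩
  filter_upwards [k.continuous_toFun.continuousAt.eventually hsσ] with z hz
  obtain ⟨hz, hz2⟩ := hz
  refine ⟨(mem_ker_monadMap f' z _).mpr ((h z).2 _ ((mem_ker_monadMap f _ _).mp hz)), ?_⟩
  rw [hz2]
  rfl

/-- The identity map. -/
def RegularMap.id (V : Type u) [AddCommGroup V] [Module ℂ V] : RegularMap V V :=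
  ⟨fun x => x, continuous_id, fun _ _ h => h⟩

/-- Proportional antisymmetric isomorphisms have isomorphic null correlation bundles. -/
def isoOfSmul {f f' : SkewIso V} {a : ℂ} (ha : a ≠ 0)
    (h : ∀ u v, f.toEquiv u v = a * f'.toEquiv u v) :
    nullCorrelationBundle f ≅ nullCorrelationBundle f' :=
  have h1 : ∀ y, FibreCompat f f' (LinearEquiv.refl ℂ V) y y := fun y =>
    .of_scale ha h ⟨1, one_ne_zero, (one_smul ℂ _).symm⟩
  have h2 : ∀ y, FibreCompat f' f (LinearEquiv.refl ℂ V) y y := fun y =>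
    .of_scale (inv_ne_zero ha) (fun u v => by simp [h, ha])
      ⟨1, one_ne_zero, (one_smul ℂ _).symm⟩
  { hom := Hom.mk (E := nullCorrelationBundle f) (F := nullCorrelationBundle f')
      (fun y => fibreTransport (h1 y)) fun s x hs =>
        regular_fibreTransport (.id V) h1 s x hs
    inv := Hom.mk (E := nullCorrelationBundle f') (F := nullCorrelationBundle f)
      (fun y => fibreTransport (h2 y)) fun s x hs =>
        regular_fibreTransport (.id V) h2 s x hs
    hom_inv_id := hom_ext fun y => LinearMap.ext fun z =>
      fibreTransport_fibreTransport (h1 y) (h2 y) (fun _ => rfl) z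
    inv_hom_id := hom_ext fun y => LinearMap.ext fun z =>
      fibreTransport_fibreTransport (h2 y) (h1 y) (fun _ => rfl) z }

/-- `κ̄^* N(f) ≅ N(f')`, `[w] ↦ [κ⁻¹ w]`, if `f'` is a multiple of `ᵀκ ∘ f ∘ κ`. -/
def pullbackIso {f f' : SkewIso V} (κ : V ≃ₗ[ℂ] V) {a : ℂ} (ha : a ≠ 0)
    (h : ∀ u v, f.toEquiv (κ u) (κ v) = a * f'.toEquiv u v) :
    (pullback (projMap κ)).obj (nullCorrelationBundle f) ≅ nullCorrelationBundle f' :=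
  { hom := Hom.mk (E := (pullback (projMap κ)).obj (nullCorrelationBundle f))
        (F := nullCorrelationBundle f')
        (fun y => fibreTransport (FibreCompat.symm_projMap ha h y)) fun t x ht => by
      obtain ⟨ι, _, c, s, hc, hs, hts⟩ := ht
      -- Transport is linear on fibres, so it suffices to treat the sections of N(f) that occur in
      -- the local expression of t.
      have h4 := regular_sum (E := nullCorrelationBundle f') (I := Finset.univ) fun i _ =>
        regular_smul (hc i) (regular_fibreTransport (projMap κ)
          (FibreCompat.symm_projMap ha h) (s i) x (hs i))
      refine AlgVectorBundle.Regular.congr h4 ?_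
      filter_upwards [hts] with z hz
      refine Eq.trans ?_ (congrArg (fibreTransport (FibreCompat.symm_projMap ha h z)) hz).symm
      rw [map_sum]
      simp_rw [map_smul]
    inv := Hom.mk (E := nullCorrelationBundle f')
        (F := (pullback (projMap κ)).obj (nullCorrelationBundle f))
        (fun y => fibreTransport (FibreCompat.projMap ha h y)) fun t x ht => by
      -- One section of N(f) with coefficient 1 suffices: since κ̄ is invertible, the image of t is
      -- the inverse image of the section z ↦ [κ t(κ̄⁻¹ z)].
      refine ⟨Unit, inferInstance, fun _ _ => 1,
        fun _ z => fibreTransport (FibreCompat.projMap_symm ha h z) (t ((projMap κ.symm).toFun z)),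
        fun _ => regularAt_const 1 _, fun _ => ?_, Filter.Eventually.of_forall fun z => ?_⟩
      · refine regular_fibreTransport (projMap κ.symm) (FibreCompat.projMap_symm ha h) t _ ?_
        rwa [projMap_symm_projMap]
      · simp only [Finset.univ_unique, Finset.sum_singleton, one_smul]
        -- The points κ̄⁻¹(κ̄ z) and z are equal only propositionally, and t takes values in fibres
        -- that depend on the point; with a free point z' the equality can be substituted.
        have key : ∀ z' (hz : z' = z) (hc : FibreCompat f' f κ z' ((projMap κ).toFun z)),
            fibreTransport (FibreCompat.projMap ha h z) (t z) = fibreTransport hc (t z') := by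
          rintro _ rfl _
          rfl
        exact key _ (projMap_symm_projMap κ z) _
    hom_inv_id := hom_ext fun y => LinearMap.ext fun z =>
      fibreTransport_fibreTransport (FibreCompat.symm_projMap ha h y) (FibreCompat.projMap ha h y)
        κ.apply_symm_apply z
    inv_hom_id := hom_ext fun y => LinearMap.ext fun z =>
      fibreTransport_fibreTransport (FibreCompat.projMap ha h y) (FibreCompat.symm_projMap ha h y)
        κ.symm_apply_apply z }

theorem pullbackIso_hom_nullClass {f f' : SkewIso V} (κ : V ≃ₗ[ℂ] V) {a : ℂ} (ha : a ≠ 0)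
    (h : ∀ u v, f.toEquiv (κ u) (κ v) = a * f'.toEquiv u v) (x : ℙ ℂ V)
    (w' : LinearMap.ker (fibreMap (monadMap f) ((projMap κ).toFun x)))
    (w : LinearMap.ker (fibreMap (monadMap f') x)) (hw : (w'.1 : V) = κ w.1) :
    fibreMap (pullbackIso κ ha h).hom x (nullClass f ((projMap κ).toFun x) w') =
      nullClass f' x w :=
  fibreTransport_nullClass (.symm_projMap ha h x) _ _ ((κ.symm_apply_eq).mpr hw).symm

end Maps

/-! ### Restriction to lines, and recovery of the form from its isotropic lines -/

section Lines

variable {V : Type u} [AddCommGroup V] [Module ℂ V]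

theorem differentiable_polyEval_line (P : MvPolynomial (Module.Dual ℂ V) ℂ) (a b : V) :
    Differentiable ℂ fun z : ℂ => polyEval P (a + z • b) := by
  unfold polyEval
  induction P using MvPolynomial.induction_on with
  | C c => simp
  | add P Q hP hQ =>
    simp only [map_add] at hP hQ ⊢
    exact hP.fun_add hQ
  | mul_X P l hP =>
    simp only [map_mul, MvPolynomial.eval_X, map_add, map_smul, smul_eq_mul] at hP ⊢
    exact hP.mul (by fun_prop)

theorem exists_mk_rep_eq_smul {v : V} (hv : v ≠ 0) :
    ∃ c : ℂ, c ≠ 0 ∧ (Projectivization.mk ℂ v hv).rep = c • v := by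
  obtain ⟨a, ha⟩ := Projectivization.exists_smul_eq_mk_rep ℂ v hv
  exact ⟨a, a.ne_zero, ha.symm⟩

/-- An affine line in `V ∖ {0}` maps continuously to `ℙ(V)`. -/
theorem continuous_mk_line (a b : V) (hab : ∀ z : ℂ, a + z • b ≠ 0) :
    Continuous fun z : ℂ => Projectivization.mk ℂ (a + z • b) (hab z) := by
  refine continuous_generateFrom_iff.mpr ?_
  rintro U ⟨d, P, hP, rfl⟩
  have : (fun z : ℂ => Projectivization.mk ℂ (a + z • b) (hab z)) ⁻¹' basicOpen P =
      {z | polyEval P (a + z • b) ≠ 0} := by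
    ext z
    obtain ⟨c, hc, hz⟩ := exists_mk_rep_eq_smul (hab z)
    simp only [Set.mem_preimage, basicOpen, Set.mem_ofPred_eq, hz, polyEval_smul hP]
    simp [hc]
  rw [this]
  -- Here ℂ carries its usual topology and ℙ(V) the Zariski topology, so that limits and Liouville's
  -- theorem become available.
  exact isOpen_ne_fun (differentiable_polyEval_line P a b).continuous continuous_const

/-- The function `F` is regular along the linear subspace `ℙ(W)` of `ℙ(V)`. -/
def RegularAlong (W : Submodule ℂ V) (F : ℙ ℂ V → ℂ) : Prop :=
  ∀ x : ℙ ℂ V, x.rep ∈ W → ∃ G, RegularAt G x ∧ ∀ᶠ y in 𝓝 x, y.rep ∈ W → F y = G y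

/-- Locally F is a quotient P/Q of homogeneous polynomials of the same degree. The scalar between
the chosen representative of a point and a + z b cancels, which leaves a quotient of polynomial
functions of z. -/
theorem RegularAlong.differentiable {W : Submodule ℂ V} {F : ℙ ℂ V → ℂ} (hF : RegularAlong W F)
    {a b : V} (ha : a ∈ W) (hb : b ∈ W) (hab : ∀ z : ℂ, a + z • b ≠ 0) :
    Differentiable ℂ fun z : ℂ => F (Projectivization.mk ℂ (a + z • b) (hab z)) := by
  have hW : ∀ z : ℂ, (Projectivization.mk ℂ (a + z • b) (hab z)).rep ∈ W := fun z => by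
    obtain ⟨c, -, hz⟩ := exists_mk_rep_eq_smul (hab z)
    rw [hz]
    exact W.smul_mem _ (W.add_mem ha (W.smul_mem _ hb))
  intro z₀
  obtain ⟨G, ⟨d, P, Q, hP, hQ, hG⟩, hFG⟩ := hF _ (hW z₀)
  have key : ∀ᶠ z in 𝓝 z₀, polyEval Q (a + z • b) ≠ 0 ∧
      F (Projectivization.mk ℂ (a + z • b) (hab z)) =
        polyEval P (a + z • b) / polyEval Q (a + z • b) := by
    filter_upwards [(continuous_mk_line a b hab).continuousAt.eventually hG,
      (continuous_mk_line a b hab).continuousAt.eventually hFG] with z hz hz2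
    obtain ⟨c, hc, hr⟩ := exists_mk_rep_eq_smul (hab z)
    rw [hr, polyEval_smul hP, polyEval_smul hQ] at hz
    exact ⟨right_ne_zero_of_mul hz.1, by
      rw [hz2 (hW z), hz.2, mul_div_mul_left _ _ (pow_ne_zero d hc)]⟩
  exact (((differentiable_polyEval_line P a b) z₀).fun_div
    ((differentiable_polyEval_line Q a b) z₀) key.self_of_nhds.1).congr_of_eventuallyEq
      (key.mono fun z hz => hz.2)

/-- A function which is regular along a projective line is constant along that line. -/
theorem RegularAlong.apply_eq {W : Submodule ℂ V} {F : ℙ ℂ V → ℂ} (hF : RegularAlong W F)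
    {a b : V} (ha : a ∈ W) (hb : b ∈ W) (hab : LinearIndependent ℂ ![a, b]) (ha₀ : a ≠ 0)
    (hb₀ : b ≠ 0) : F (Projectivization.mk ℂ a ha₀) = F (Projectivization.mk ℂ b hb₀) := by
  have h1 : ∀ z : ℂ, a + z • b ≠ 0 := fun z hz => by
    simpa using (LinearIndependent.pair_iff.mp hab 1 z (by simpa using hz)).1
  have h2 : ∀ z : ℂ, b + z • a ≠ 0 := fun z hz => by
    simpa using (LinearIndependent.pair_iff.mp hab z 1 (by simpa [add_comm] using hz)).2
  -- Since [a + z b] = [b + z⁻¹ a], continuity at 0 in the other chart gives the limit F([b]) as z →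
  -- ∞. An entire function with a limit at infinity equals that limit everywhere, in particular at z
  -- = 0.
  have hlim := (hF.differentiable hb ha h2 0).continuousAt.tendsto.comp
    (Filter.tendsto_inv₀_cobounded (α := ℂ))
  rw [Metric.cobounded_eq_cocompact] at hlim
  have h3 := (hF.differentiable ha hb h1).apply_eq_of_tendsto_cocompact 0 (hlim.congr' (by
    have h0 : ∀ᶠ z : ℂ in Filter.cocompact ℂ, z ≠ 0 := by
      rw [← Metric.cobounded_eq_cocompact]
      exact Bornology.eventually_ne_cobounded 0
    filter_upwards [h0] with z hz
    refine congrArg F ((Projectivization.mk_eq_mk_iff' ℂ _ _ _ _).mpr ⟨z⁻¹, ?_⟩)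
    rw [smul_add, smul_smul, inv_mul_cancel₀ hz, one_smul, add_comm]))
  simpa using h3

/-- The section `s` of `E` is regular along the linear subspace `ℙ(W)` of `ℙ(V)`. -/
def AlgVectorBundle.SectionRegularAlong (E : AlgVectorBundle V) (W : Submodule ℂ V)
    (s : ∀ x, E.fibre x) : Prop :=
  ∀ x : ℙ ℂ V, x.rep ∈ W → ∃ t, E.Regular t x ∧ ∀ᶠ y in 𝓝 x, y.rep ∈ W → s y = t y

theorem AlgVectorBundle.SectionRegularAlong.map {E F : AlgVectorBundle V} (φ : E ⟶ F)
    {W : Submodule ℂ V} {s : ∀ x, E.fibre x} (hs : E.SectionRegularAlong W s) :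
    F.SectionRegularAlong W fun x => fibreMap φ x (s x) := by
  intro x hx
  obtain ⟨t, ht, hst⟩ := hs x hx
  exact ⟨_, Hom.map_regular φ t x ht, hst.mono fun y hy hyW => congrArg _ (hy hyW)⟩

variable [FiniteDimensional ℂ V]

open Classical in
/-- The section of `N(f)` represented by the section `σ` of `V ⊗ 𝒪` (and zero where `σ` is not in
the kernel of `V ⊗ 𝒪 → 𝒪(1)`). -/
def nullSection (f : SkewIso V) (σ : ℙ ℂ V → V) (y : ℙ ℂ V) :
    (nullCorrelationBundle f).fibre y :=
  if h : f.toEquiv (σ y) y.rep = 0 then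
    nullClass f y ⟨σ y, (mem_ker_monadMap f y _).mpr h⟩ else 0

theorem nullSection_eq {f : SkewIso V} {σ : ℙ ℂ V → V} {y : ℙ ℂ V}
    (h : f.toEquiv (σ y) y.rep = 0) :
    nullSection f σ y = nullClass f y ⟨σ y, (mem_ker_monadMap f y _).mpr h⟩ :=
  dif_pos h

/-- Along an isotropic line `ℙ(W)` every `u ∈ W` defines a regular section of `N(f)`. -/
theorem sectionRegularAlong_nullSection {f : SkewIso V} {W : Submodule ℂ V} {u : V}
    (hW : ∀ v ∈ W, f.toEquiv u v = 0) :
    (nullCorrelationBundle f).SectionRegularAlong W (nullSection f fun _ => u) := by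
  intro x hx
  obtain ⟨w₀, hw₀⟩ : ∃ w₀, f.toEquiv w₀ x.rep ≠ 0 := by
    by_contra! h
    refine x.rep_nonzero (f.toEquiv.map_eq_zero_iff.mp (LinearMap.ext fun w => ?_))
    rw [f.skew, h]
    simp
  -- Away from ℙ(W) the vector u need not be orthogonal to y. A multiple of w₀ corrects this near x;
  -- the correction vanishes on ℙ(W), because u is orthogonal to W.
  let σ : ℙ ℂ V → V := fun y => u - (f.toEquiv u y.rep / f.toEquiv w₀ y.rep) • w₀
  have hσ : ∀ᶠ y in 𝓝 x, f.toEquiv (σ y) y.rep = 0 := by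
    filter_upwards [eventually_apply_ne_zero (f.toEquiv w₀) hw₀] with y hy
    simp [σ, hy]
  refine ⟨nullSection f σ, ⟨σ, fun l => ?_, ?_⟩, Filter.Eventually.of_forall fun y hy => ?_⟩
  · refine ((regularAt_const (l u) x).sub ((regularAt_div (f.toEquiv u) (f.toEquiv w₀) hw₀).mul
      (regularAt_const (l w₀) x))).congr (Filter.Eventually.of_forall fun y => ?_)
    simp [σ]
  · filter_upwards [hσ] with y hy
    exact ⟨(mem_ker_monadMap f y _).mpr hy, nullSection_eq hy⟩
  · have : σ y = u := by simp [σ, hW _ hy]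
    simp only [nullSection, this]

/-- Along a line which is not isotropic `N(f)` is trivial: a section which is regular along the line
and vanishes at one point of the line vanishes at any other. -/
theorem eq_zero_of_sectionRegularAlong {f : SkewIso V} {u v : V} (huv : f.toEquiv u v ≠ 0)
    (hli : LinearIndependent ℂ ![u, v]) (hu₀ : u ≠ 0) (hv₀ : v ≠ 0)
    {s : ∀ x, (nullCorrelationBundle f).fibre x}
    (hs : (nullCorrelationBundle f).SectionRegularAlong (Submodule.span ℂ {u, v}) s)
    (hsu : s (Projectivization.mk ℂ u hu₀) = 0) :
    s (Projectivization.mk ℂ v hv₀) = 0 := by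
  -- p is the projection of V onto W^⊥ along W = span {u, v}; it exists because f(u,v) ≠ 0.
  let p : V →ₗ[ℂ] V := LinearMap.id - (f.toEquiv u v)⁻¹ •
    ((f.toEquiv.toLinearMap.flip v).smulRight u - (f.toEquiv.toLinearMap.flip u).smulRight v)
  have hp : ∀ w, p w = w - (f.toEquiv u v)⁻¹ •
    (f.toEquiv w v • u - f.toEquiv w u • v) := fun w => rfl
  have hpW : ∀ w ∈ Submodule.span ℂ {u, v}, p w = 0 := by
    intro w hw
    obtain ⟨c, d, rfl⟩ := Submodule.mem_span_pair.mp hw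
    have hvu : f.toEquiv v u = - f.toEquiv u v := f.skew _ _
    simp only [hp, map_add, map_smul, LinearMap.add_apply, LinearMap.smul_apply, f.alternating, hvu,
      smul_eq_mul]
    match_scalars <;> field_simp <;> ring
  -- The representatives are arbitrary, without any regularity in y; on ℙ(W) the vector p (w y)
  -- nevertheless depends only on s y.
  choose w hw using fun y => exists_nullClass (s y)
  have hF : ∀ l : Module.Dual ℂ V,
      RegularAlong (Submodule.span ℂ {u, v}) fun y => l (p (w y).1) := by
    intro l x hx
    obtain ⟨t, ⟨σ, hσ, htσ⟩, hst⟩ := hs x hx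
    refine ⟨fun y => l (p (σ y)), hσ (l ∘ₗ p), ?_⟩
    filter_upwards [htσ, hst] with y hy hy2 hyW
    obtain ⟨hy, hty⟩ := hy
    -- Two representatives of one class differ by a vector of the line y, which p kills when y lies
    -- in W.
    have h0 : nullClass f y (w y - ⟨σ y, hy⟩) = 0 := by
      refine (map_sub (CohomologyFibre.proj _ _ y) _ _).trans (sub_eq_zero.mpr ?_)
      exact (hw y).symm.trans ((hy2 hyW).trans hty)
    obtain ⟨c, hc⟩ := (nullClass_eq_zero_iff f y _).mp h0
    have h1 : p ((w y).1 - σ y) = 0 := by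
      refine (congrArg p hc).trans ?_
      rw [map_smul, hpW _ hyW, smul_zero]
    rw [map_sub] at h1
    rw [sub_eq_zero.mp h1]
  have hmem : u ∈ Submodule.span ℂ {u, v} := Submodule.subset_span (by simp)
  have hmem' : v ∈ Submodule.span ℂ {u, v} := Submodule.subset_span (by simp)
  rw [hw, nullClass_eq_zero_iff] at hsu ⊢
  obtain ⟨c, hc⟩ := hsu
  obtain ⟨a, ha, hu⟩ := exists_mk_rep_eq_smul hu₀
  obtain ⟨b, hb, hv⟩ := exists_mk_rep_eq_smul hv₀
  have h2 : p (w (Projectivization.mk ℂ v hv₀)).1 = 0 := by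
    refine (Module.forall_dual_apply_eq_zero_iff ℂ _).mp fun l => ?_
    rw [← (hF l).apply_eq hmem hmem' hli hu₀ hv₀]
    have : p (w (Projectivization.mk ℂ u hu₀)).1 = 0 := by
      refine (congrArg p hc).trans ?_
      rw [map_smul, hu, map_smul, hpW u hmem, smul_zero, smul_zero]
    rw [this, map_zero]
  -- Being killed by p, the representative at [v] lies in W. It is also orthogonal to v, so its
  -- u-component vanishes and it is a multiple of v.
  have h3 := (mem_ker_monadMap f _ _).mp (w (Projectivization.mk ℂ v hv₀)).2
  rw [hv] at h3 ⊢
  generalize (w (Projectivization.mk ℂ v hv₀)).1 = w' at h2 h3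
  rw [map_smul, smul_eq_mul, mul_eq_zero, or_iff_right hb] at h3
  rw [hp, h3, zero_smul, zero_sub, sub_eq_zero] at h2
  refine ⟨-((f.toEquiv u v)⁻¹ * f.toEquiv w' u * b⁻¹), h2.trans ?_⟩
  simp [smul_smul, hb]

/-- A morphism of null correlation bundles which is injective on fibres preserves isotropy of
lines. -/
theorem isotropic_of_hom {f₁ f₂ : SkewIso V}
    (φ : nullCorrelationBundle f₁ ⟶ nullCorrelationBundle f₂)
    (hφ : ∀ x, Function.Injective (fibreMap φ x)) {u v : V} (huv : f₁.toEquiv u v = 0) :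
    f₂.toEquiv u v = 0 := by
  by_contra h
  -- Pairing a linear relation with v on the right, and with u on the left, isolates each
  -- coefficient, as f₂(u,v) ≠ 0.
  have hli : LinearIndependent ℂ ![u, v] := by
    rw [LinearIndependent.pair_iff]
    intro a b hab
    have h1 := congrArg (fun w => f₂.toEquiv w v) hab
    have h2 := congrArg (fun w => f₂.toEquiv u w) hab
    simp only [map_add, map_smul, LinearMap.add_apply, LinearMap.smul_apply, f₂.alternating,
      map_zero, LinearMap.zero_apply, smul_eq_mul, mul_zero, add_zero, zero_add, mul_eq_zero, h,
      or_false] at h1 h2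
    exact ⟨h1, h2⟩
  have hW : ∀ w ∈ Submodule.span ℂ {u, v}, f₁.toEquiv u w = 0 := by
    intro w hw
    obtain ⟨c, d, rfl⟩ := Submodule.mem_span_pair.mp hw
    simp [f₁.alternating, huv]
  have hu₀ : u ≠ 0 := hli.ne_zero 0
  have hv₀ : v ≠ 0 := hli.ne_zero 1
  obtain ⟨a, ha, hu⟩ := exists_mk_rep_eq_smul hu₀
  obtain ⟨b, hb, hv⟩ := exists_mk_rep_eq_smul hv₀
  -- The section defined by u vanishes at [u], hence so does its image in N(f₂); triviality along
  -- the line makes the image vanish at [v], and injectivity of φ brings this back to N(f₁). Then u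
  -- would be a multiple of v.
  have h0 := eq_zero_of_sectionRegularAlong h hli hu₀ hv₀
    ((sectionRegularAlong_nullSection hW).map φ) (by
    rw [nullSection_eq (by rw [hu, map_smul, f₁.alternating, smul_zero]),
      (nullClass_eq_zero_iff _ _ _).mpr
        ⟨a⁻¹, ((congrArg (a⁻¹ • ·) hu).trans (inv_smul_smul₀ ha u)).symm⟩, map_zero])
  rw [(injective_iff_map_eq_zero' _).mp (hφ _),
    nullSection_eq (by rw [hv, map_smul, huv, smul_zero]), nullClass_eq_zero_iff] at h0
  obtain ⟨c, hc⟩ := h0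
  change u = _ at hc
  rw [hv, smul_smul] at hc
  have := (LinearIndependent.pair_iff.mp hli 1 (-(c * b)) (by
    rw [one_smul, neg_smul]
    exact add_neg_eq_zero.mpr hc)).1
  exact one_ne_zero this

-- For each u the kernel of f₁(u) is contained in that of f₂(u), so f₂(u) is a multiple of f₁(u).
-- Every vector is thus an eigenvector of f₁⁻¹ ∘ f₂, which forces this map to be a scalar
-- independent of u.
omit [FiniteDimensional ℂ V] in
theorem exists_eq_smul_of_isotropic {f₁ f₂ : SkewIso V}
    (h : ∀ u v, f₁.toEquiv u v = 0 → f₂.toEquiv u v = 0) :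
    ∃ a : ℂ, ∀ u, f₂.toEquiv u = a • f₁.toEquiv u := by
  obtain ⟨a, ha⟩ := LinearMap.exists_eq_smul_id_of_forall_notLinearIndependent
    (f := (f₂.toEquiv.trans f₁.toEquiv.symm).toLinearMap) fun u hu => by
      obtain ⟨c, hc⟩ : ∃ c : ℂ, f₂.toEquiv u = c • f₁.toEquiv u := by
        by_cases hu0 : f₁.toEquiv u = 0
        · exact ⟨0, by simp [f₁.toEquiv.map_eq_zero_iff.mp hu0]⟩
        · obtain ⟨v, hv⟩ : ∃ v, f₁.toEquiv u v ≠ 0 := by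
            by_contra! h
            exact hu0 (LinearMap.ext h)
          refine ⟨f₂.toEquiv u v / f₁.toEquiv u v, LinearMap.ext fun w => ?_⟩
          -- The component of w along v is removed so that the difference is f₁-orthogonal to u,
          -- hence also f₂-orthogonal.
          have := h u (w - (f₁.toEquiv u w / f₁.toEquiv u v) • v) (by simp [hv])
          rw [map_sub, map_smul, sub_eq_zero, smul_eq_mul] at this
          rw [this, LinearMap.smul_apply, smul_eq_mul]
          ring
      have := LinearIndependent.pair_iff.mp hu c (-1) (by simp [hc])
      simpa using this.2
  refine ⟨a, fun u => f₁.toEquiv.symm.injective ?_⟩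
  simpa using LinearMap.congr_fun ha u

end Lines

/-! ### The diagonal action and the cocycle rule -/

section Action

variable {V : Type u} [AddCommGroup V] [Module ℂ V]

/-- An antidiagonal form pairs b_i only with its mirror image b_{rev i}, and the weights of such a
pair add up to d. -/
theorem apply_diagAction {n : ℕ} {b : Module.Basis (Fin (2 * n + 2)) ℂ V} {r : Fin (n + 1) → ℂ}
    {f : SkewIso V} {a : Fin (2 * n + 2) → ℤ} {d : ℤ}
    (hf : LinearMap.toMatrix b b.dualBasis f.toEquiv.toLinearMap = specialMatrix r)
    (ha : ∀ i, a i + a i.rev = d) (t : ℂˣ) (u v : V) :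
    f.toEquiv (diagAction b a t u) (diagAction b a t v) = (t : ℂ) ^ d * f.toEquiv u v := by
  -- The indices are exchanged: column i of the matrix contains the coordinates of f(b_i) in the
  -- dual basis.
  have hb : ∀ i j, f.toEquiv (b i) (b j) = specialMatrix r j i := fun i j => by
    rw [← hf, LinearMap.toMatrix_apply, Module.Basis.dualBasis_repr]
    rfl
  have key : (f.toEquiv.toLinearMap.compl₁₂ (diagAction b a t).toLinearMap
      (diagAction b a t).toLinearMap) = (t : ℂ) ^ d • f.toEquiv.toLinearMap := by
    refine b.ext fun i => b.ext fun j => ?_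
    simp only [LinearMap.compl₁₂_apply, LinearEquiv.coe_coe, diagAction_apply, map_smul,
      LinearMap.smul_apply, hb, smul_eq_mul]
    by_cases hij : i = j.rev
    · rw [← ha j, zpow_add₀ t.ne_zero, hij]
      ring
    · simp [specialMatrix, hij]
  exact LinearMap.congr_fun (LinearMap.congr_fun key u) v

theorem diagAction_diagAction {m : ℕ} (b : Module.Basis (Fin m) ℂ V) (a : Fin m → ℤ) (t₁ t₂ : ℂˣ)
    (u : V) : diagAction b a t₁ (diagAction b a t₂ u) = diagAction b a (t₁ * t₂) u := by
  refine LinearMap.congr_fun (f := (diagAction b a t₁).toLinearMap ∘ₗ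
    (diagAction b a t₂).toLinearMap) (g := (diagAction b a (t₁ * t₂)).toLinearMap)
    (b.ext fun i => ?_) u
  simp [diagAction_apply, mul_zpow, smul_smul, mul_comm]

variable [FiniteDimensional ℂ V]

/-- Isomorphisms given by `[κ w] ↦ [w]` are compatible with composition. -/
theorem pullbackComp_cocycle {f : SkewIso V} {κ₁ κ₂ κ₃ : V ≃ₗ[ℂ] V} {k₁ k₂ k₃ : RegularMap V V}
    (hk : k₁.comp k₂ = k₃) (hκ : ∀ u, κ₁ (κ₂ u) = κ₃ u)
    (φ₁ : (pullback k₁).obj (nullCorrelationBundle f) ⟶ nullCorrelationBundle f)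
    (φ₂ : (pullback k₂).obj (nullCorrelationBundle f) ⟶ nullCorrelationBundle f)
    (φ₃ : (pullback k₃).obj (nullCorrelationBundle f) ⟶ nullCorrelationBundle f)
    (h₁ : ∀ (x : ℙ ℂ V) (w : LinearMap.ker (fibreMap (monadMap f) x))
      (w' : LinearMap.ker (fibreMap (monadMap f) (k₁.toFun x))), (w'.1 : V) = κ₁ w.1 →
        fibreMap φ₁ x (nullClass f (k₁.toFun x) w') = nullClass f x w)
    (h₂ : ∀ (x : ℙ ℂ V) (w : LinearMap.ker (fibreMap (monadMap f) x))
      (w' : LinearMap.ker (fibreMap (monadMap f) (k₂.toFun x))), (w'.1 : V) = κ₂ w.1 →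
        fibreMap φ₂ x (nullClass f (k₂.toFun x) w') = nullClass f x w)
    (h₃ : ∀ (x : ℙ ℂ V) (w : LinearMap.ker (fibreMap (monadMap f) x))
      (w' : LinearMap.ker (fibreMap (monadMap f) (k₃.toFun x))), (w'.1 : V) = κ₃ w.1 →
        fibreMap φ₃ x (nullClass f (k₃.toFun x) w') = nullClass f x w)
    (hker₁ : ∀ (x : ℙ ℂ V), ∀ w ∈ LinearMap.ker (fibreMap (monadMap f) (k₁.toFun x)),
      κ₁.symm w ∈ LinearMap.ker (fibreMap (monadMap f) x))
    (hker₂ : ∀ (x : ℙ ℂ V), ∀ w ∈ LinearMap.ker (fibreMap (monadMap f) (k₂.toFun x)),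
      κ₂.symm w ∈ LinearMap.ker (fibreMap (monadMap f) x)) :
    (pullbackComp k₁ k₂ (nullCorrelationBundle f)).hom ≫
        (pullbackCongr hk (nullCorrelationBundle f)).hom ≫ φ₃ =
      (pullback k₂).map φ₁ ≫ φ₂ := by
  -- With k₃ a variable, the substitution turns `pullbackCongr` into the identity; the rule can then
  -- be checked on classes [w], where both sides give [κ₂⁻¹ κ₁⁻¹ w].
  subst hk
  refine hom_ext fun x => LinearMap.ext fun z => ?_
  obtain ⟨⟨w, hw⟩, rfl⟩ := exists_nullClass (f := f) (x := k₁.toFun (k₂.toFun x)) z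
  have hw₁ := hker₁ _ w hw
  have hw₂ := hker₂ x _ hw₁
  have e₁ := h₁ _ ⟨_, hw₁⟩ ⟨w, hw⟩ (κ₁.apply_symm_apply w).symm
  have e₂ := h₂ x ⟨_, hw₂⟩ ⟨_, hw₁⟩ (κ₂.apply_symm_apply _).symm
  have e₃ := h₃ x ⟨_, hw₂⟩ ⟨w, hw⟩ (by
    rw [← hκ, LinearEquiv.apply_symm_apply, LinearEquiv.apply_symm_apply])
  exact e₃.trans ((congrArg (fibreMap φ₂ x) e₁).trans e₂).symm

theorem symm_mem_ker_monadMap {f : SkewIso V} {κ : V ≃ₗ[ℂ] V} {a : ℂ} (ha : a ≠ 0)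
    (h : ∀ u v, f.toEquiv (κ u) (κ v) = a * f.toEquiv u v) (x : ℙ ℂ V) (w : V)
    (hw : w ∈ LinearMap.ker (fibreMap (monadMap f) ((projMap κ).toFun x))) :
    κ.symm w ∈ LinearMap.ker (fibreMap (monadMap f) x) :=
  (mem_ker_monadMap f x _).mpr
    ((FibreCompat.symm_projMap ha h x).2 w ((mem_ker_monadMap f _ w).mp hw))

theorem exists_compatible_isos {n : ℕ} {b : Module.Basis (Fin (2 * n + 2)) ℂ V}
    {r : Fin (n + 1) → ℂ} {f : SkewIso V} {a : Fin (2 * n + 2) → ℤ} {d : ℤ}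
    (hf : LinearMap.toMatrix b b.dualBasis f.toEquiv.toLinearMap = specialMatrix r)
    (ha : ∀ i, a i + a i.rev = d) :
    ∃ s : ∀ t : ℂˣ, (pullback (projAction b a t)).obj (nullCorrelationBundle f) ≅
        nullCorrelationBundle f,
      (∀ (t : ℂˣ) (x : ℙ ℂ V) (w : LinearMap.ker (fibreMap (monadMap f) x))
        (w' : LinearMap.ker (fibreMap (monadMap f) ((projAction b a t).toFun x))),
        (w'.1 : V) = diagAction b a t w.1 →
          fibreMap (s t).hom x (nullClass f ((projAction b a t).toFun x) w') =
            nullClass f x w) ∧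
      ∀ t₁ t₂ : ℂˣ,
        (pullbackComp (projAction b a t₁) (projAction b a t₂) (nullCorrelationBundle f)).hom ≫
            (pullbackCongr (projAction_mul b a t₁ t₂) (nullCorrelationBundle f)).hom ≫
              (s (t₁ * t₂)).hom =
          (pullback (projAction b a t₂)).map (s t₁).hom ≫ (s t₂).hom := by
  have hs : ∀ t : ℂˣ, (t : ℂ) ^ d ≠ 0 := fun t => zpow_ne_zero _ t.ne_zero
  have hw : ∀ (t : ℂˣ) (x : ℙ ℂ V) (w : LinearMap.ker (fibreMap (monadMap f) x))
      (w' : LinearMap.ker (fibreMap (monadMap f) ((projAction b a t).toFun x))),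
      (w'.1 : V) = diagAction b a t w.1 →
        fibreMap (pullbackIso (diagAction b a t) (hs t) (apply_diagAction hf ha t)).hom x
          (nullClass f ((projAction b a t).toFun x) w') = nullClass f x w := fun t x w w' h =>
    pullbackIso_hom_nullClass _ (hs t) (apply_diagAction hf ha t) x w' w h
  refine ⟨fun t => pullbackIso (diagAction b a t) (hs t) (apply_diagAction hf ha t), hw,
    fun t₁ t₂ => ?_⟩
  exact pullbackComp_cocycle (projAction_mul b a t₁ t₂) (diagAction_diagAction b a t₁ t₂)
    _ _ _ (hw t₁) (hw t₂) (hw (t₁ * t₂))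
    (symm_mem_ker_monadMap (hs t₁) (apply_diagAction hf ha t₁))
    (symm_mem_ker_monadMap (hs t₂) (apply_diagAction hf ha t₂))

end Action

end

end NullCorrelation

theorem proposition1p4p6 (n : ℕ) (V : Type u) [AddCommGroup V] [Module ℂ V]
    [FiniteDimensional ℂ V] (hV : Module.finrank ℂ V = 2 * n + 2) :
    (∀ f₁ f₂ : SkewIso V,
      Nonempty (nullCorrelationBundle f₁ ≅ nullCorrelationBundle f₂) ↔
        ∃ a : ℂ, a ≠ 0 ∧ ∀ u : V, f₁.toEquiv u = a • f₂.toEquiv u) ∧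
    (∀ (κ : V ≃ₗ[ℂ] V) (f : SkewIso V),
      Nonempty ((pullback (projMap κ)).obj (nullCorrelationBundle f) ≅
        nullCorrelationBundle (f.conj κ))) ∧
    (∀ (b : Module.Basis (Fin (2 * n + 2)) ℂ V) (r : Fin (n + 1) → ℂ) (f : SkewIso V)
      (a : Fin (2 * n + 2) → ℤ) (d : ℤ),
      (∀ i, r i ≠ 0) →
      LinearMap.toMatrix b b.dualBasis f.toEquiv.toLinearMap = specialMatrix r →
      (∀ i, a i + a i.rev = d) →
      ∃ s : ∀ t : ℂˣ, (pullback (projAction b a t)).obj (nullCorrelationBundle f) ≅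
          nullCorrelationBundle f,
        (∀ (t : ℂˣ) (x : ℙ ℂ V) (w : LinearMap.ker (fibreMap (monadMap f) x))
          (w' : LinearMap.ker (fibreMap (monadMap f) ((projAction b a t).toFun x))),
          (w'.1 : V) = diagAction b a t w.1 →
            fibreMap (s t).hom x (nullClass f ((projAction b a t).toFun x) w') =
              nullClass f x w) ∧
        ∀ t₁ t₂ : ℂˣ,
          (pullbackComp (projAction b a t₁) (projAction b a t₂) (nullCorrelationBundle f)).hom ≫
              (pullbackCongr (projAction_mul b a t₁ t₂) (nullCorrelationBundle f)).hom ≫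
                (s (t₁ * t₂)).hom =
            (pullback (projAction b a t₂)).map (s t₁).hom ≫ (s t₂).hom) := by
  refine ⟨fun f₁ f₂ => ⟨?_, ?_⟩, fun κ f => ?_, fun b r f a d _ hf ha => ?_⟩
  · rintro ⟨φ⟩
    -- The inverse N(f₂) → N(f₁) is used because f₁ is to be written as a multiple of f₂.
    obtain ⟨a, ha⟩ := exists_eq_smul_of_isotropic fun u v => isotropic_of_hom φ.inv
      (fun x => Function.LeftInverse.injective (g := fibreMap φ.hom x) fun z =>
        LinearMap.congr_fun (congrArg (fibreMap · x) φ.inv_hom_id) z) (u := u) (v := v)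
    refine ⟨a, ?_, ha⟩
    rintro rfl
    -- If a were 0, then f₁ would be 0, which is impossible for an isomorphism on a space of
    -- dimension 2n + 2 > 0.
    have : Nontrivial V := Module.nontrivial_of_finrank_pos (R := ℂ) (by omega)
    obtain ⟨v, hv⟩ := exists_ne (0 : V)
    exact hv (f₁.toEquiv.map_eq_zero_iff.mp (by rw [ha, zero_smul]))
  · rintro ⟨a, ha, h⟩
    exact ⟨isoOfSmul ha fun u v => by rw [h]; rfl⟩
  · exact ⟨pullbackIso κ one_ne_zero fun u v => (one_mul _).symm⟩
  · exact exists_compatible_isos hf ha
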